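/- \textbf{Setting.} Let $(\Omega,\mathcal F,\mathbb P)$ be a probability space with a filtration $(\mathcal F_t)_{t\ge 0}$, let $z_\ast\in\mathbb R^d$, let $\Gamma\in\mathbb R^{p\times p}$ be symmetric positive definite, and let $u_t=S_tz_\ast+w_t$, $t\ge1$, where the random matrices $S_t\in\mathbb R^{p\times d}$ and the noise vectors $w_t\sim\mathcal N(0,\Gamma)$ are $\mathcal F_t$-measurable, and for every $t\ge 0$ the vector $w_{t+1}$ is independent of $\mathcal F_t\vee\sigma(S_{t+1})$ (so the noise is i.i.d.). Suppose that $\|S_t^\top S_t\|\le A_{\max}$ almost surely for all $t\ge1$, where $\|\cdot\|$ is the operator norm. \textbf{Periodic averaging assumption.} There is a symmetric matrix $A\in\mathbb R^{d\times d}$ with $0\preceq A\preceq I$, and for every $\varepsilon>0$ an integer $\tau_\varepsilon\ge 1$ of order $\varepsilon^{-1}$ (that is, $\tau_\varepsilon\ge c\,\varepsilon^{-1}$ for all $\varepsilon>0$ and $\tau_\varepsilon\le c'\varepsilon^{-1}$ for all $0<\varepsilon\le1$, with constants $c,c'>0$), such that for all $t\ge 1$, almost surely, $$\Big\|\mathbb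 E\Big[\frac1{\tau_\varepsilon}\sum_{k=0}^{\tau_\varepsilon-1}S_{t+1+k}^\top S_{t+1+k}\,\Big|\,\mathcal F_t\Big]-A\Big\|\le\varepsilon .$$ \textbf{Objective.} For a fixed $\alpha>0$ let $J(z)=\frac12 (z-z_\ast)^\top A(z-z_\ast)+\frac\alpha2\|z\|^2$, with minimizer $z^{\mathrm{opt}}=(A+\alpha I)^{-1}Az_\ast$, and let $\mu>0$ be a strong convexity constant of $J$, i.e. $A+\alpha I\succeq\mu I$ (for example $\mu=\alpha$). \textbf{Algorithm.} Let $h>0$, and let $z_0^{(1)},\dots,z_0^{(J)}$ be square-integrable $\mathcal F_0$-measurable random vectors in $\mathbb R^d$ (by abuse of notation $J$ is also the number of particles). For $t\ge0$ let $$z_{t+1}^{(j)}=z_t^{(j)}-h\,C_t\big(S_{t+1}^\top(S_{t+1}z_t^{(j)}-u_{t+1})+\alpha z_t^{(j)}\big),\qquad \bar z_t=\frac1J\sum_{j=1}^Jz_t^{(j)},\qquad C_t=\frac1J\sum_{j=1}^J(z_t^{(j)}-\bar z_t)(z_t^{(j)}-\bar z_t)^\top .$$ Suppose that $C_0\succ\sigma_lI$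 almost surely for some $\sigma_l>0$ with $\lambda:=2\mu\sigma_l\in(0,1)$, and that, almost surely, $$h\le\min\Big(\frac{\alpha}{J(A_{\max}+\alpha)^2},\frac J\alpha\Big)E_0^{-1},\qquad E_0=\frac1J\sum_{j=1}^J\|z_0^{(j)}-\bar z_0\|^2 .$$ \textbf{Theorem.} For every $T\ge 0$ the excess loss $J(\bar z_T)-J(z^{\mathrm{opt}})$ is integrable. There is a constant $K$, independent of $\varepsilon$ and $T$, such that for all $\varepsilon>0$ and all integers $T\ge1$ $$\mathbb E\big[J(\bar z_T)-J(z^{\mathrm{opt}})\big]\le K\Big(\varepsilon+\frac{1+(1+\log\tau_\varepsilon)^2+(1+\log\tau_\varepsilon)(1+\log T)}{T^\lambda}\Big).$$ In particular (taking $\varepsilon=1/T$), there is a constant $K'$ such that for all integers $T\ge2$ $$\mathbb E\big[J(\bar z_T)-J(z^{\mathrm{opt}})\big]\le K'\,\frac{(\log T)^2}{T^\lambda}.$$ -/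

import Mathlib

open MeasureTheory ProbabilityTheory Filter
open scoped Matrix Matrix.Norms.L2Operator

noncomputable section

namespace DEKI

/-! ### The optimization problem -/

/-- The regularized objective `½ ⟨z - z⋆, A (z - z⋆)⟩ + (α / 2) ‖z‖²` (Euclidean norm), whose
gradient is `(A + α I) z - A z⋆`. -/
def objective {d : ℕ} (A : Matrix (Fin d) (Fin d) ℝ) (α : ℝ) (zstar z : Fin d → ℝ) : ℝ :=
  (1 / 2) * ((z - zstar) ⬝ᵥ (A *ᵥ (z - zstar))) + (α / 2) * (z ⬝ᵥ z)

/-- The minimizer `(A + α I)⁻¹ A z⋆` of the objective. -/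
def zOpt {d : ℕ} (A : Matrix (Fin d) (Fin d) ℝ) (α : ℝ) (zstar : Fin d → ℝ) : Fin d → ℝ :=
  (A + α • (1 : Matrix (Fin d) (Fin d) ℝ))⁻¹ *ᵥ (A *ᵥ zstar)

/-! ### Ensembles and the iteration -/

/-- Mean of an ensemble of `J` particles in `ℝᵈ`. -/
def ensembleMean {J d : ℕ} (z : Fin J → Fin d → ℝ) : Fin d → ℝ :=
  (1 / (J : ℝ)) • ∑ j, z j

/-- Deviation of the `j`-th particle from the ensemble mean. -/
def deviation {J d : ℕ} (z : Fin J → Fin d → ℝ) (j : Fin J) : Fin d → ℝ :=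
  z j - ensembleMean z

/-- Sample covariance `(1 / J) ∑ⱼ eⱼ eⱼᵀ` of an ensemble. -/
def sampleCov {J d : ℕ} (z : Fin J → Fin d → ℝ) : Matrix (Fin d) (Fin d) ℝ :=
  (1 / (J : ℝ)) • ∑ j, Matrix.vecMulVec (deviation z j) (deviation z j)

/-- Ensemble spread `(1 / J) ∑ⱼ ‖eⱼ‖²` (Euclidean norm). -/
def spread {J d : ℕ} (z : Fin J → Fin d → ℝ) : ℝ :=
  (1 / (J : ℝ)) * ∑ j, deviation z j ⬝ᵥ deviation z j

/-- One step of the iteration with constant step size `h`, operator `S` and observation `u`: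
`zⱼ - h C (Sᵀ (S zⱼ - u) + α zⱼ)`, where `C` is the sample covariance of the ensemble. -/
def step {J p d : ℕ} (α h : ℝ) (S : Matrix (Fin p) (Fin d) ℝ) (u : Fin p → ℝ)
    (z : Fin J → Fin d → ℝ) : Fin J → Fin d → ℝ :=
  fun j => z j - h • (sampleCov z *ᵥ (Sᵀ *ᵥ (S *ᵥ z j - u) + α • z j))

/-- The dynamic ensemble Kalman iteration without perturbed observations; the step from time `t`
to time `t + 1` uses the operator and the observation at time `t + 1`. -/
def ensemble {J p d : ℕ} (α h : ℝ) (S : ℕ → Matrix (Fin p) (Fin d) ℝ) (u : ℕ → Fin p → ℝ)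
    (z₀ : Fin J → Fin d → ℝ) : ℕ → Fin J → Fin d → ℝ
  | 0 => z₀
  | t + 1 => step α h (S (t + 1)) (u (t + 1)) (ensemble α h S u z₀ t)

/-! ### The observation model -/

section Model

variable {Ω : Type*} [mΩ : MeasurableSpace Ω]

/-- Entrywise conditional expectation of a random matrix. -/
def condExpMatrix {m n : ℕ} (P : Measure Ω) (𝓖 : MeasurableSpace Ω)
    (M : Ω → Matrix (Fin m) (Fin n) ℝ) (ω : Ω) : Matrix (Fin m) (Fin n) ℝ :=
  Matrix.of fun i j => (P[fun ω' => M ω' i j | 𝓖]) ω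

/-- The observation at time `t`: `uₜ = Sₜ z⋆ + wₜ`. -/
def observation {p d : ℕ} (S : ℕ → Ω → Matrix (Fin p) (Fin d) ℝ) (w : ℕ → Ω → Fin p → ℝ)
    (zstar : Fin d → ℝ) (t : ℕ) (ω : Ω) : Fin p → ℝ :=
  S t ω *ᵥ zstar + w t ω

/-- The standing assumptions on operators `Sₜ` and noise `wₜ`, `t ≥ 1`, relative to a filtration
`ℱ`: both are adapted (hence so are the observations), `wₜ ∼ N(0, Γ)`, and `wₜ₊₁` is independent
of the past `ℱₜ` together with the operator `Sₜ₊₁`. In particular the noise is i.i.d. -/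
structure IsObservationModel {p d : ℕ} (P : Measure Ω) (ℱ : Filtration ℕ mΩ)
    (S : ℕ → Ω → Matrix (Fin p) (Fin d) ℝ) (w : ℕ → Ω → Fin p → ℝ)
    (Γ : Matrix (Fin p) (Fin p) ℝ) : Prop where
  operator_adapted : ∀ t i j, Measurable[ℱ (t + 1)] (fun ω => S (t + 1) ω i j)
  noise_adapted : ∀ t, Measurable[ℱ (t + 1)] (w (t + 1))
  noise_law : ∀ t, HasLaw (fun ω => WithLp.toLp 2 (w (t + 1) ω)) (multivariateGaussian 0 Γ) P
  noise_indep : ∀ t, Indep (MeasurableSpace.comap (w (t + 1)) inferInstance)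
    (ℱ t ⊔ MeasurableSpace.comap
      (fun ω => (fun i j => S (t + 1) ω i j : Fin p → Fin d → ℝ)) inferInstance) P

/-- Periodic averaging: the matrix `A` satisfies `0 ⪯ A ⪯ I`, and for every `ε > 0` the conditional
expectation, given `ℱₜ`, of the average of `Sₛᵀ Sₛ` over the `τ ε` times `s = t + 1, …, t + τ ε` is
almost surely within `ε` of `A` in operator norm, for all `t ≥ 1`. The window length `τ ε` is of
order `1 / ε`: it is at least `c / ε` for all `ε > 0`, and at most `c' / ε` for `ε ≤ 1`. -/
structure IsPeriodicAveraging {p d : ℕ} (P : Measure Ω) (ℱ : Filtration ℕ mΩ)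
    (S : ℕ → Ω → Matrix (Fin p) (Fin d) ℝ) (A : Matrix (Fin d) (Fin d) ℝ) (τ : ℝ → ℕ) : Prop where
  posSemidef : A.PosSemidef
  le_one : (1 - A).PosSemidef
  window_lower : ∃ c : ℝ, 0 < c ∧ ∀ ε : ℝ, 0 < ε → c / ε ≤ (τ ε : ℝ)
  window_upper : ∃ c' : ℝ, ∀ ε : ℝ, 0 < ε → ε ≤ 1 → (τ ε : ℝ) ≤ c' / ε
  averaging : ∀ ε : ℝ, 0 < ε → ∀ t : ℕ, 1 ≤ t → ∀ᵐ ω ∂P,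
    ‖condExpMatrix P (ℱ t) (fun ω' => (1 / (τ ε : ℝ)) •
        ∑ k ∈ Finset.range (τ ε), (S (t + 1 + k) ω')ᵀ * S (t + 1 + k) ω') ω - A‖ ≤ ε

end Model

end DEKI

end

/-!
Write `D t = h C_t` for the rescaled sample covariance, `B t = SᵀS + α I` for the regularized Gram
matrix of the step from `t` to `t + 1`, and `Φ t` for the product of the factors `I - D s B s`,
`s < t`. The deviations of the particles are transported by these factors, so `D t = Φ t D₀ (Φ t)ᵀ`.
The step size condition gives `tr D (t + 1) ≤ tr D t - (α / d) (tr D t)²`, hence `D t` is of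
order `1 / t` along almost every trajectory. Since `D₀ ≥ h σ_l I`, the identity for `D t` turns this
into `‖Φ t‖² = O(1 / t)` (`IsCovarianceFlow.norm_propagator_sq_le`). Thus the preconditioning by the
ensemble contracts the error of the mean at the rate `1 / t` in square, whatever the conditioning of
the problem; this is why every exponent `lam < 1` is admissible.

The error `x t` of the mean satisfies `x (t + 1) = x t - D t (B t x t + ξ t)`, where the forcing
`ξ t = (SᵀS - A) (zOpt - z⋆) - Sᵀ w` consists of the fluctuation of the operators and the noise.
Variation of constants (`IsCovarianceFlow.eq_propagator_mulVec`) gives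
`x T = Φ T (x 0 - ∑_{s < T} G s R s ξ s)` with the gain `G s = D₀ (Φ s)ᵀ`, of size `1 / √s`, and
the resolvent `R s = (I - B s D s)⁻¹`, which is `I + O(1 / s)`. The inner sum involves only
information up to the current step, and its second moment grows like a power of `log T`
(`hasLogMoments_forcing`):

* the noise part is a martingale transform with weights of size `1 / √s`;
* in the operator part, `R s` may be replaced by `I` at the cost of a harmonic sum. The
  conditional expectation, given the past, of the sum of `SᵀS - A` over a window of length `m` is
  `O(1 + log m)`: exhaust the window by pieces of length `τ ε` with `ε` of the order of the inverse
  of the remaining length, each of which contributes `O(1)` (`IsAveraged.condExp_window_le`). So the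
  expected future sums are `O(1 + log T)`, and they solve a Poisson equation that writes `SᵀS - A`
  as a martingale difference of size `O(1 + log T)` minus an increment of these sums. The
  increments are summed by parts, as `G (s + 1) - G s = O(1 / s)` (`IsAveraged.integral_sq_weighted_sum_le`).

Consequently the mean-square error is `O((1 + log T)⁴ / T)`, which is `O(T ^ (-lam))` for `lam < 1`.
Both asserted bounds follow, since their right-hand sides dominate `T ^ (-lam)`.
-/

namespace DEKI

/-! ### The operator norm and the trace -/

section Norms

variable {m n : ℕ}

lemma dotProduct_self_mulVec_le (M : Matrix (Fin m) (Fin n) ℝ) (x : Fin n → ℝ) :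
    (M *ᵥ x) ⬝ᵥ (M *ᵥ x) ≤ ‖M‖ ^ 2 * (x ⬝ᵥ x) := by
  have hsq : ∀ {k : ℕ} (y : Fin k → ℝ), y ⬝ᵥ y = ‖WithLp.toLp 2 y‖ ^ 2 := fun y => by
    rw [EuclideanSpace.norm_sq_eq]
    simp [dotProduct, pow_two]
  rw [hsq, hsq, ← mul_pow]
  exact pow_le_pow_left₀ (norm_nonneg _) (M.l2_opNorm_mulVec (WithLp.toLp 2 x)) 2

lemma abs_entry_le_norm (M : Matrix (Fin m) (Fin n) ℝ) (i : Fin m) (j : Fin n) :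
    |M i j| ≤ ‖M‖ := by
  have h := dotProduct_self_mulVec_le M (Pi.single j 1)
  have h1 : (Pi.single j (1 : ℝ) : Fin n → ℝ) ⬝ᵥ Pi.single j 1 = 1 := by simp
  rw [h1, mul_one] at h
  have h2 : (M i j) ^ 2 ≤ (M *ᵥ Pi.single j 1) ⬝ᵥ (M *ᵥ Pi.single j 1) := by
    simp only [Matrix.mulVec_single_one, dotProduct, Matrix.col_apply]
    have := Finset.single_le_sum (f := fun k => M k j * M k j)
      (fun k _ => mul_self_nonneg _) (Finset.mem_univ i)
    simpa [pow_two] using this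
  exact abs_le_of_sq_le_sq (h2.trans h) (norm_nonneg _)

lemma norm_transpose (M : Matrix (Fin m) (Fin n) ℝ) : ‖Mᵀ‖ = ‖M‖ := by
  rw [← Matrix.conjTranspose_eq_transpose_of_trivial]; exact M.l2_opNorm_conjTranspose

lemma norm_transpose_mul_self (M : Matrix (Fin m) (Fin n) ℝ) : ‖Mᵀ * M‖ = ‖M‖ ^ 2 := by
  rw [← Matrix.conjTranspose_eq_transpose_of_trivial, M.l2_opNorm_conjTranspose_mul_self, pow_two]

lemma trace_transpose_mul_self (M : Matrix (Fin m) (Fin n) ℝ) :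
    (Mᵀ * M).trace = ∑ j, (M *ᵥ Pi.single j 1) ⬝ᵥ (M *ᵥ Pi.single j 1) := by
  simp [Matrix.trace, Matrix.mul_apply, dotProduct, Matrix.diag]

/-- The operator norm is at most the Frobenius norm. -/
lemma norm_sq_le_trace (M : Matrix (Fin m) (Fin n) ℝ) : ‖M‖ ^ 2 ≤ (Mᵀ * M).trace := by
  have h0 : 0 ≤ (Mᵀ * M).trace := by
    rw [trace_transpose_mul_self]
    exact Finset.sum_nonneg fun j _ => Finset.sum_nonneg fun i _ => mul_self_nonneg _
  rw [← Real.le_sqrt (norm_nonneg _) h0, Matrix.l2_opNorm_def]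
  refine ContinuousLinearMap.opNorm_le_bound _ (Real.sqrt_nonneg _) fun x => ?_
  refine (sq_le_sq₀ (norm_nonneg _) (by positivity)).mp ?_
  rw [mul_pow, Real.sq_sqrt h0, EuclideanSpace.norm_sq_eq, EuclideanSpace.norm_sq_eq]
  have e : (Mᵀ * M).trace = ∑ i, ∑ j, M i j ^ 2 := by
    rw [Finset.sum_comm]
    simp [Matrix.trace, Matrix.mul_apply, pow_two]
  rw [e, Finset.sum_mul]
  refine Finset.sum_le_sum fun i _ => ?_
  have := Finset.sum_mul_sq_le_sq_mul_sq Finset.univ (fun j => M i j) (fun j => x j)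
  simpa [Matrix.toLpLin_apply, Matrix.mulVec, dotProduct] using this

open scoped MatrixOrder in
lemma exists_eq_transpose_mul_self {D : Matrix (Fin n) (Fin n) ℝ} (hD : D.PosSemidef) :
    ∃ F : Matrix (Fin n) (Fin n) ℝ, D = Fᵀ * F := by
  obtain ⟨F, hF⟩ := CStarAlgebra.nonneg_iff_eq_star_mul_self.mp hD.nonneg
  exact ⟨F, by rw [hF, Matrix.star_eq_conjTranspose,
    Matrix.conjTranspose_eq_transpose_of_trivial]⟩

lemma norm_le_trace {D : Matrix (Fin n) (Fin n) ℝ} (hD : D.PosSemidef) : ‖D‖ ≤ D.trace := by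
  obtain ⟨F, rfl⟩ := exists_eq_transpose_mul_self hD
  rw [norm_transpose_mul_self]
  exact norm_sq_le_trace F

lemma trace_mul_le {l : ℕ} (M : Matrix (Fin m) (Fin n) ℝ) (X : Matrix (Fin n) (Fin l) ℝ) :
    ((M * X)ᵀ * (M * X)).trace ≤ ‖M‖ ^ 2 * (Xᵀ * X).trace := by
  rw [trace_transpose_mul_self, trace_transpose_mul_self, Finset.mul_sum]
  refine Finset.sum_le_sum fun j _ => ?_
  rw [← Matrix.mulVec_mulVec]
  exact dotProduct_self_mulVec_le _ _

lemma sq_trace_le (D : Matrix (Fin n) (Fin n) ℝ) : D.trace ^ 2 ≤ n * (Dᵀ * D).trace := by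
  have h1 : D.trace ^ 2 ≤ n * ∑ i, D i i ^ 2 := by
    have := sq_sum_le_card_mul_sum_sq (s := Finset.univ) (f := fun i : Fin n => D i i)
    simpa [Matrix.trace] using this
  refine h1.trans (mul_le_mul_of_nonneg_left ?_ (Nat.cast_nonneg n))
  have e : (Dᵀ * D).trace = ∑ j, ∑ i, D i j ^ 2 := by
    simp [Matrix.trace, Matrix.mul_apply, pow_two]
  rw [e]
  exact Finset.sum_le_sum fun j _ => Finset.single_le_sum (f := fun i => D i j ^ 2)
    (fun i _ => sq_nonneg _) (Finset.mem_univ j)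

lemma norm_one_le : ‖(1 : Matrix (Fin n) (Fin n) ℝ)‖ ≤ 1 := by
  rw [← Matrix.diagonal_one, Matrix.l2_opNorm_diagonal]
  exact (pi_norm_le_iff_of_nonneg zero_le_one).mpr fun i => by simp

end Norms

/-! ### The covariance recursion -/

section Covariance

variable {d : ℕ} {α β σ : ℝ} {D B : ℕ → Matrix (Fin d) (Fin d) ℝ}

/-- One step of the covariance recursion lowers the trace by at least `α tr(D²) ≥ (α / d) (tr D)²`;
this is the source of the decay of the covariance like `1 / t`. -/
lemma trace_step_le {D B : Matrix (Fin d) (Fin d) ℝ} (hD : D.PosSemidef) (hα : 0 ≤ α)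
    (hBt : Bᵀ = B) (hBα : (B - α • (1 : Matrix (Fin d) (Fin d) ℝ)).PosSemidef) (hBβ : ‖B‖ ≤ β)
    (hDβ : D.trace * β ^ 2 ≤ α) :
    d * ((1 - D * B) * D * (1 - D * B)ᵀ).trace ≤ d * D.trace - α * D.trace ^ 2 := by
  have hDt : Dᵀ = D := by
    have := hD.isHermitian.eq; rwa [Matrix.conjTranspose_eq_transpose_of_trivial] at this
  have e : ((1 - D * B) * D * (1 - D * B)ᵀ).trace
      = D.trace - 2 * (D * B * D).trace + (D * B * D * B * D).trace := by
    have : (1 - D * B) * D * (1 - D * B)ᵀ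
        = D - D * B * D - D * B * D + D * B * D * B * D := by
      rw [Matrix.transpose_sub, Matrix.transpose_mul, hBt, hDt, Matrix.transpose_one]
      noncomm_ring
    rw [this, Matrix.trace_add, Matrix.trace_sub, Matrix.trace_sub]; ring
  have h1 : α * (Dᵀ * D).trace ≤ (D * B * D).trace := by
    have h := (hBα.mul_mul_conjTranspose_same D).trace_nonneg
    rw [Matrix.conjTranspose_eq_transpose_of_trivial, hDt] at h
    have e2 : D * (B - α • (1 : Matrix (Fin d) (Fin d) ℝ)) * D = D * B * D - α • (D * D) := by
      rw [Matrix.mul_sub, Matrix.sub_mul]; simp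
    rw [e2, Matrix.trace_sub, Matrix.trace_smul, smul_eq_mul] at h
    rw [hDt]; linarith
  have h2 : (D * B * D * B * D).trace ≤ α * (Dᵀ * D).trace := by
    obtain ⟨F, hF⟩ := exists_eq_transpose_mul_self hD
    have e2 : D * B * D * B * D = (F * (B * D))ᵀ * (F * (B * D)) := by
      rw [Matrix.transpose_mul, Matrix.transpose_mul, hBt, hDt]
      calc D * B * D * B * D = D * B * (Fᵀ * F) * B * D := by rw [← hF]
        _ = _ := by simp only [Matrix.mul_assoc]
    have hDD : 0 ≤ (Dᵀ * D).trace := (sq_nonneg ‖D‖).trans (norm_sq_le_trace D)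
    have hD0 : 0 ≤ D.trace := hD.trace_nonneg
    have hFD : ‖F‖ ^ 2 ≤ D.trace := by rw [hF]; exact norm_sq_le_trace F
    have hβ2 : ‖B‖ ^ 2 ≤ β ^ 2 := pow_le_pow_left₀ (norm_nonneg _) hBβ 2
    rw [e2]
    calc _ ≤ ‖F‖ ^ 2 * ((B * D)ᵀ * (B * D)).trace := trace_mul_le _ _
      _ ≤ ‖F‖ ^ 2 * (‖B‖ ^ 2 * (Dᵀ * D).trace) :=
        mul_le_mul_of_nonneg_left (trace_mul_le _ _) (sq_nonneg _)
      _ ≤ D.trace * (β ^ 2 * (Dᵀ * D).trace) := by gcongr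
      _ = D.trace * β ^ 2 * (Dᵀ * D).trace := by ring
      _ ≤ _ := mul_le_mul_of_nonneg_right hDβ hDD
  have h3 := sq_trace_le D
  have hd : (0 : ℝ) ≤ d := Nat.cast_nonneg d
  have h4 : ((1 - D * B) * D * (1 - D * B)ᵀ).trace ≤ D.trace - α * (Dᵀ * D).trace := by
    rw [e]; linarith
  nlinarith [mul_le_mul_of_nonneg_left h4 hd, mul_le_mul_of_nonneg_left h3 hα]

/-- A sequence with `e (t + 1) ≤ e t - a (e t)²` is at most `1 / (a (t + 1))`. -/
lemma le_inv_of_sub_sq {a : ℝ} (ha : 0 < a) {e : ℕ → ℝ} (he0 : a * e 0 ≤ 1) (hpos : ∀ t, 0 ≤ e t)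
    (hs : ∀ t, e (t + 1) ≤ e t - a * e t ^ 2) (t : ℕ) : a * e t * (t + 1) ≤ 1 := by
  induction t with
  | zero => simpa using he0
  | succ t ih =>
    have h1 := hs t
    have h0 := hpos t
    have ht : (0 : ℝ) ≤ t := Nat.cast_nonneg t
    push_cast
    set y := a * e t with hy
    have hy0 : 0 ≤ y := mul_nonneg ha.le h0
    have h2 : a * e (t + 1) ≤ y - y ^ 2 := by
      have := mul_le_mul_of_nonneg_left h1 ha.le
      rw [hy]; nlinarith
    have h3 : a * e (t + 1) * (t + 1 + 1) ≤ (y - y ^ 2) * (t + 1 + 1) :=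
      mul_le_mul_of_nonneg_right h2 (by positivity)
    refine h3.trans ?_
    -- `y (1 - y) (t + 2) ≤ 1` follows from `(t + 1) y ≤ 1`, by cases on `(t + 2) y ≤ 1`
    by_cases hc : y * (t + 1 + 1) ≤ 1
    · nlinarith [mul_nonneg (sq_nonneg y) (by linarith : (0:ℝ) ≤ t + 1 + 1)]
    · push Not at hc
      nlinarith [mul_nonneg hy0 (by linarith : (0:ℝ) ≤ y * (t + 1 + 1) - 1)]

/-- The hypotheses on the rescaled sample covariances `D t = h C_t` and the regularized Gram
matrices `B t = Sᵀ S + α I` (with `S` the operator of the step from `t` to `t + 1`) that hold along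
almost every trajectory. -/
structure IsCovarianceFlow (α β σ : ℝ) (D B : ℕ → Matrix (Fin d) (Fin d) ℝ) : Prop where
  pos_zero : (D 0).PosSemidef
  lower_zero : (D 0 - σ • (1 : Matrix (Fin d) (Fin d) ℝ)).PosSemidef
  trace_zero : (D 0).trace * β ^ 2 ≤ α / 2
  step_eq : ∀ t, D (t + 1) = (1 - D t * B t) * D t * (1 - D t * B t)ᵀ
  symm : ∀ t, (B t)ᵀ = B t
  lower : ∀ t, (B t - α • (1 : Matrix (Fin d) (Fin d) ℝ)).PosSemidef
  norm_le : ∀ t, ‖B t‖ ≤ β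

/-- The propagator `Φ t = (I - D (t-1) B (t-1)) ⋯ (I - D 0 B 0)` of the noiseless linear dynamics of
the ensemble mean. -/
noncomputable def propagator (D B : ℕ → Matrix (Fin d) (Fin d) ℝ) :
    ℕ → Matrix (Fin d) (Fin d) ℝ
  | 0 => 1
  | t + 1 => (1 - D t * B t) * propagator D B t

/-- The gain `G t = D 0 (Φ t)ᵀ`; where `Φ t` is invertible it equals `(Φ t)⁻¹ D t`. -/
noncomputable def gain (D B : ℕ → Matrix (Fin d) (Fin d) ℝ) (t : ℕ) : Matrix (Fin d) (Fin d) ℝ :=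
  D 0 * (propagator D B t)ᵀ

/-- The resolvent `(I - B t D t)⁻¹`. -/
noncomputable def resolvent (D B : ℕ → Matrix (Fin d) (Fin d) ℝ) (t : ℕ) :
    Matrix (Fin d) (Fin d) ℝ :=
  (1 - B t * D t)⁻¹

namespace IsCovarianceFlow

lemma posSemidef (hf : IsCovarianceFlow α β σ D B) (t : ℕ) : (D t).PosSemidef := by
  induction t with
  | zero => exact hf.pos_zero
  | succ t ih =>
    rw [hf.step_eq]
    rw [← Matrix.conjTranspose_eq_transpose_of_trivial]
    exact ih.mul_mul_conjTranspose_same (1 - D t * B t)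

lemma transpose_eq (hf : IsCovarianceFlow α β σ D B) (t : ℕ) : (D t)ᵀ = D t := by
  have := (hf.posSemidef t).isHermitian.eq
  rwa [Matrix.conjTranspose_eq_transpose_of_trivial] at this

lemma trace_step (hf : IsCovarianceFlow α β σ D B) (hα : 0 < α) (hd : 0 < d) (t : ℕ) :
    (D t).trace ≤ (D 0).trace ∧ (D (t + 1)).trace ≤ (D t).trace - α / d * (D t).trace ^ 2 := by
  have hd' : (0 : ℝ) < d := Nat.cast_pos.mpr hd
  have key : ∀ t, (D t).trace ≤ (D 0).trace →
      (D (t + 1)).trace ≤ (D t).trace - α / d * (D t).trace ^ 2 := fun t ht => by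
    have h := trace_step_le (β := β) (hf.posSemidef t) hα.le (hf.symm t) (hf.lower t)
      (hf.norm_le t) (by nlinarith [hf.trace_zero, mul_le_mul_of_nonneg_right ht (sq_nonneg β)])
    rw [← hf.step_eq] at h
    have e : d * ((D t).trace - α / d * (D t).trace ^ 2)
        = d * (D t).trace - α * (D t).trace ^ 2 := by
      field_simp
    exact le_of_mul_le_mul_left (h.trans e.ge) hd'
  have hle : (D t).trace ≤ (D 0).trace := by
    induction t with
    | zero => exact le_rfl
    | succ t ih =>
      have := key t ih
      have h2 : 0 ≤ α / d * (D t).trace ^ 2 := by positivity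
      linarith
  exact ⟨hle, key t hle⟩

lemma trace_le (hf : IsCovarianceFlow α β σ D B) (hα : 0 < α) (hαβ : α ≤ β) (hd : 0 < d) (t : ℕ) :
    (D t).trace ≤ d / α / (t + 1) := by
  have hd' : (1 : ℝ) ≤ d := Nat.one_le_cast.mpr hd
  have h0 := (hf.pos_zero).trace_nonneg
  have h := le_inv_of_sub_sq (a := α / d) (by positivity) (e := fun t => (D t).trace) ?_
    (fun t => (hf.posSemidef t).trace_nonneg) (fun t => (hf.trace_step hα hd t).2) t
  · rw [div_div, le_div_iff₀ (by positivity)]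
    calc (D t).trace * (α * (t + 1)) = d * (α / d * (D t).trace * (t + 1)) := by field_simp
      _ ≤ d * 1 := by gcongr
      _ = d := mul_one _
  · have h1 : α ^ 2 * (D 0).trace ≤ α / 2 := by
      nlinarith [hf.trace_zero, mul_le_mul_of_nonneg_left (pow_le_pow_left₀ hα.le hαβ 2) h0]
    have h2 : α * (D 0).trace ≤ 1 := by nlinarith
    rw [div_mul_eq_mul_div, div_le_one (by positivity)]
    linarith

/-- The covariance at time `t` is the initial one, transported by the propagator. -/
lemma eq_propagator (hf : IsCovarianceFlow α β σ D B) (t : ℕ) :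
    D t = propagator D B t * D 0 * (propagator D B t)ᵀ := by
  induction t with
  | zero => simp [propagator]
  | succ t ih =>
    rw [hf.step_eq, propagator, Matrix.transpose_mul]
    conv_lhs => enter [1, 2]; rw [ih]
    simp only [Matrix.mul_assoc]

/-- Since `D 0 ≥ σ I`, the propagator is controlled by the covariance: `σ Φ Φᵀ ≤ D t`. This replaces
any lower bound on the spectrum of `D t`. -/
lemma norm_propagator_sq_le (hf : IsCovarianceFlow α β σ D B) (hα : 0 < α) (hαβ : α ≤ β)
    (hσ : 0 < σ) (hd : 0 < d) (t : ℕ) :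
    ‖propagator D B t‖ ^ 2 ≤ d / α / σ / (t + 1) := by
  set Φ := propagator D B t with hΦ
  have h1 := (hf.lower_zero.mul_mul_conjTranspose_same Φ).trace_nonneg
  rw [Matrix.conjTranspose_eq_transpose_of_trivial, Matrix.mul_sub, Matrix.sub_mul,
    ← hf.eq_propagator t, Matrix.trace_sub] at h1
  have h2 : (Φ * (σ • (1 : Matrix (Fin d) (Fin d) ℝ)) * Φᵀ).trace = σ * (Φ * Φᵀ).trace := by simp
  have h3 : ‖Φ‖ ^ 2 ≤ (Φ * Φᵀ).trace := by
    have := norm_sq_le_trace Φᵀ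
    rwa [norm_transpose, Matrix.transpose_transpose] at this
  have h4 := hf.trace_le hα hαβ hd t
  rw [div_right_comm, le_div_iff₀ hσ]
  nlinarith

lemma norm_le_trace_zero (hf : IsCovarianceFlow α β σ D B) (hα : 0 < α) (hd : 0 < d) (t : ℕ) :
    ‖D t‖ ≤ (D 0).trace :=
  (norm_le_trace (hf.posSemidef t)).trans (hf.trace_step hα hd t).1

lemma norm_mul_le_half (hf : IsCovarianceFlow α β σ D B) (hα : 0 < α) (hαβ : α ≤ β) (hd : 0 < d)
    (t : ℕ) : ‖B t * D t‖ ≤ 1 / 2 := by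
  have hβ : 0 < β := hα.trans_le hαβ
  have h0 := (hf.pos_zero).trace_nonneg
  calc ‖B t * D t‖ ≤ ‖B t‖ * ‖D t‖ := Matrix.l2_opNorm_mul _ _
    _ ≤ β * (D 0).trace :=
      mul_le_mul (hf.norm_le t) (hf.norm_le_trace_zero hα hd t) (norm_nonneg _) hβ.le
    _ ≤ 1 / 2 := by
      have h1 : (β * (D 0).trace) * β ≤ (1 / 2) * β := by nlinarith [hf.trace_zero]
      exact le_of_mul_le_mul_right h1 hβ

lemma resolvent_spec (hf : IsCovarianceFlow α β σ D B) (hα : 0 < α) (hαβ : α ≤ β) (hd : 0 < d)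
    (t : ℕ) : (1 - B t * D t) * resolvent D B t = 1 ∧ resolvent D B t * (1 - B t * D t) = 1 ∧
      ‖resolvent D B t‖ ≤ 2 := by
  have hn := hf.norm_mul_le_half hα hαβ hd t
  have hcomplete : CompleteSpace (Matrix (Fin d) (Fin d) ℝ) := FiniteDimensional.complete ℝ _
  have hu : IsUnit (1 - B t * D t) :=
    isUnit_one_sub_of_norm_lt_one (hn.trans_lt (by norm_num))
  have hdet : IsUnit (1 - B t * D t).det := (Matrix.isUnit_iff_isUnit_det _).mp hu
  have h1 := Matrix.mul_nonsing_inv _ hdet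
  have h2 := Matrix.nonsing_inv_mul _ hdet
  refine ⟨h1, h2, ?_⟩
  have e : resolvent D B t = 1 + resolvent D B t * (B t * D t) := by
    have : resolvent D B t * (1 - B t * D t) = 1 := h2
    rw [Matrix.mul_sub, Matrix.mul_one] at this
    rw [← this]; abel
  have h3 : ‖resolvent D B t‖ ≤ 1 + ‖resolvent D B t‖ * (1 / 2) := by
    calc ‖resolvent D B t‖ = ‖1 + resolvent D B t * (B t * D t)‖ := by rw [← e]
      _ ≤ ‖(1 : Matrix (Fin d) (Fin d) ℝ)‖ + ‖resolvent D B t * (B t * D t)‖ := norm_add_le _ _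
      _ ≤ 1 + ‖resolvent D B t‖ * (1 / 2) := by
        refine add_le_add norm_one_le ((Matrix.l2_opNorm_mul _ _).trans ?_)
        exact mul_le_mul_of_nonneg_left hn (norm_nonneg _)
  linarith

lemma norm_le_inv (hf : IsCovarianceFlow α β σ D B) (hα : 0 < α) (hαβ : α ≤ β) (hd : 0 < d)
    (t : ℕ) : ‖D t‖ ≤ d / α / (t + 1) :=
  (norm_le_trace (hf.posSemidef t)).trans (hf.trace_le hα hαβ hd t)

lemma norm_gain_le (hf : IsCovarianceFlow α β σ D B) (hα : 0 < α) (hαβ : α ≤ β)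
    (hσ : 0 < σ) (hd : 0 < d) (t : ℕ) :
    ‖gain D B t‖ ^ 2 ≤ (d / α) ^ 2 * (d / α / σ) / (t + 1) := by
  have h1 : ‖gain D B t‖ ≤ (d / α) * ‖propagator D B t‖ := by
    refine (Matrix.l2_opNorm_mul _ _).trans ?_
    rw [norm_transpose]
    have := hf.norm_le_inv hα hαβ hd 0
    simp only [Nat.cast_zero, zero_add, div_one] at this
    gcongr
  calc ‖gain D B t‖ ^ 2 ≤ ((d / α) * ‖propagator D B t‖) ^ 2 := by gcongr
    _ = (d / α) ^ 2 * ‖propagator D B t‖ ^ 2 := by ring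
    _ ≤ (d / α) ^ 2 * (d / α / σ / (t + 1)) := by
      gcongr; exact hf.norm_propagator_sq_le hα hαβ hσ hd t
    _ = _ := by ring

lemma norm_gain_sub_le (hf : IsCovarianceFlow α β σ D B) (hα : 0 < α) (hαβ : α ≤ β) (hd : 0 < d)
    (t : ℕ) : ‖gain D B (t + 1) - gain D B t‖ ≤ ‖gain D B t‖ * (β * (d / α)) / (t + 1) := by
  have e : gain D B (t + 1) - gain D B t = -(gain D B t * (B t * D t)) := by
    simp only [gain, propagator]
    rw [Matrix.transpose_mul, Matrix.transpose_sub, Matrix.transpose_mul, hf.symm,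
      hf.transpose_eq, Matrix.transpose_one]
    noncomm_ring
  rw [e, norm_neg]
  have h1 : ‖B t * D t‖ ≤ β * (d / α / (t + 1)) :=
    (Matrix.l2_opNorm_mul _ _).trans (mul_le_mul (hf.norm_le t) (hf.norm_le_inv hα hαβ hd t)
      (norm_nonneg _) (hα.le.trans hαβ))
  calc _ ≤ ‖gain D B t‖ * ‖B t * D t‖ := Matrix.l2_opNorm_mul _ _
    _ ≤ ‖gain D B t‖ * (β * (d / α / (t + 1))) := by gcongr
    _ = _ := by ring

/-- Variation of constants in the form in which the propagator stands outside the sum: the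
summand at time `s` depends on the operators up to the step from `s` to `s + 1` only. -/
lemma eq_propagator_mulVec (hf : IsCovarianceFlow α β σ D B) (hα : 0 < α) (hαβ : α ≤ β)
    (hd : 0 < d) {x ξ : ℕ → Fin d → ℝ}
    (hx : ∀ t, x (t + 1) = x t - D t *ᵥ (B t *ᵥ x t + ξ t)) (T : ℕ) :
    x T = propagator D B T *ᵥ
      (x 0 - ∑ s ∈ Finset.range T, (gain D B s * resolvent D B s) *ᵥ ξ s) := by
  induction T with
  | zero => simp [propagator]
  | succ T ih =>
    have hR := (hf.resolvent_spec hα hαβ hd T).1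
    have hD : propagator D B T * gain D B T = D T := by
      rw [gain, ← Matrix.mul_assoc, ← hf.eq_propagator]
    have e1 : (1 - D T * B T) * propagator D B T * (gain D B T * resolvent D B T) = D T := by
      calc _ = (1 - D T * B T) * (propagator D B T * gain D B T) * resolvent D B T := by
            simp only [Matrix.mul_assoc]
        _ = D T * ((1 - B T * D T) * resolvent D B T) := by rw [hD]; noncomm_ring
        _ = D T := by rw [hR, Matrix.mul_one]
    rw [Finset.sum_range_succ, ← sub_sub, Matrix.mulVec_sub, propagator]
    rw [Matrix.mulVec_mulVec, e1, ← Matrix.mulVec_mulVec, ← ih, hx, Matrix.mulVec_add,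
      Matrix.sub_mulVec, Matrix.one_mulVec, Matrix.mulVec_mulVec]
    abel

end IsCovarianceFlow

end Covariance

/-! ### Martingale transforms and averaging -/

lemma sum_inv_le_one_add_log (T : ℕ) :
    ∑ s ∈ Finset.range T, 1 / ((s : ℝ) + 1) ≤ 1 + Real.log T := by
  refine le_trans (le_of_eq ?_) (harmonic_le_one_add_log T)
  simp [harmonic]

section Probability

variable {Ω : Type*} [mΩ : MeasurableSpace Ω] {P : Measure Ω}

/-- A bounded adapted real process whose averages over windows of length `τ ε` have conditional
expectation, given the past, at most `ε` in absolute value, where `τ ε` is of order `1 / ε`. The value `g t` belongs to time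
`t + 1`. -/
structure IsAveraged (P : Measure Ω) (ℱ : Filtration ℕ mΩ) (τ : ℝ → ℕ) (b : ℝ)
    (g : ℕ → Ω → ℝ) : Prop where
  lower : ∃ c : ℝ, 0 < c ∧ ∀ ε : ℝ, 0 < ε → c / ε ≤ (τ ε : ℝ)
  upper : ∃ c' : ℝ, ∀ ε : ℝ, 0 < ε → ε ≤ 1 → (τ ε : ℝ) ≤ c' / ε
  adapted : ∀ t, Measurable[ℱ (t + 1)] (g t)
  bounded : ∀ t, ∀ᵐ ω ∂P, |g t ω| ≤ b
  averaging : ∀ ε : ℝ, 0 < ε → ∀ t : ℕ, 1 ≤ t → ∀ᵐ ω ∂P,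
    |(P[fun ω' => (1 / (τ ε : ℝ)) * ∑ k ∈ Finset.range (τ ε), g (t + k) ω' | ℱ t]) ω| ≤ ε

namespace IsAveraged

variable {ℱ : Filtration ℕ mΩ} {τ : ℝ → ℕ} {b : ℝ} {g : ℕ → Ω → ℝ}

lemma measurable (hg : IsAveraged P ℱ τ b g) (t : ℕ) : Measurable (g t) :=
  (hg.adapted t).mono (ℱ.le _) le_rfl

/-- The expected future sum `E[∑_{s ≤ k < T} g k | ℱ s]`, which solves the Poisson equation
`E[g s + V (s + 1) | ℱ s] = V s` with terminal value `V T = 0`. -/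
noncomputable def futureSum (P : Measure Ω) (ℱ : Filtration ℕ mΩ) (g : ℕ → Ω → ℝ) (T s : ℕ) :
    Ω → ℝ :=
  P[fun ω => ∑ k ∈ Finset.Ico s T, g k ω | ℱ s]

lemma measurable_futureSum (T s : ℕ) : Measurable[ℱ s] (futureSum P ℱ g T s) :=
  stronglyMeasurable_condExp.measurable

end IsAveraged

variable [IsProbabilityMeasure P]

lemma memLp_of_ae_abs_le {f : Ω → ℝ} (hf : Measurable f) {R : ℝ}
    (hR : ∀ᵐ ω ∂P, |f ω| ≤ R) (p : ENNReal) : MemLp f p P :=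
  MemLp.of_bound hf.aestronglyMeasurable R hR

lemma integral_sq_le_of_ae_abs_le {f : Ω → ℝ} (hf : Measurable f) {R : ℝ}
    (hR : ∀ᵐ ω ∂P, |f ω| ≤ R) : ∫ ω, f ω ^ 2 ∂P ≤ R ^ 2 := by
  have h := integral_mono_ae (memLp_of_ae_abs_le hf hR 2).integrable_sq (integrable_const (R ^ 2))
    (hR.mono fun ω hω => sq_le_sq' (abs_le.mp hω).1 (abs_le.mp hω).2)
  simpa using h

/-- Second moment of a martingale transform: predictable bounded weights `H s`, square-integrable
increments `m s` that are centred given `𝓖 s`. -/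
lemma integral_sq_martingale_transform_le {𝓖 : ℕ → MeasurableSpace Ω} (h𝓖 : ∀ s, 𝓖 s ≤ mΩ)
    {H m : ℕ → Ω → ℝ} {κ : ℕ → ℝ} {ν : ℝ} {T : ℕ}
    (hH : ∀ s < T, Measurable[𝓖 s] (H s))
    (hHm : ∀ s < T, ∀ k < s, Measurable[𝓖 s] (fun ω => H k ω * m k ω))
    (hm : ∀ s < T, MemLp (m s) 2 P) (hm0 : ∀ s < T, P[m s | 𝓖 s] =ᵐ[P] 0)
    (hκ : ∀ s < T, ∀ᵐ ω ∂P, |H s ω| ≤ κ s) (hν : ∀ s < T, ∫ ω, m s ω ^ 2 ∂P ≤ ν) :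
    MemLp (fun ω => ∑ s ∈ Finset.range T, H s ω * m s ω) 2 P ∧
    ∫ ω, (∑ s ∈ Finset.range T, H s ω * m s ω) ^ 2 ∂P ≤ ν * ∑ s ∈ Finset.range T, κ s ^ 2 := by
  induction T with
  | zero => simp
  | succ T ih =>
    obtain ⟨ih1, ih2⟩ := ih (fun s hs => hH s (by omega)) (fun s hs => hHm s (by omega))
      (fun s hs => hm s (by omega)) (fun s hs => hm0 s (by omega)) (fun s hs => hκ s (by omega))
      (fun s hs => hν s (by omega))
    have hT := Nat.lt_succ_self T
    have hHT : Measurable (H T) := (hH T hT).mono (h𝓖 T) le_rfl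
    have hHmT : MemLp (fun ω => H T ω * m T ω) 2 P := by
      have := (hm T hT).mul (memLp_of_ae_abs_le hHT (hκ T hT) ⊤) (r := 2)
      exact this
    set M : Ω → ℝ := fun ω => ∑ s ∈ Finset.range T, H s ω * m s ω with hM
    have hMm : Measurable[𝓖 T] M :=
      Finset.measurable_fun_sum _ fun k hk => hHm T hT k (Finset.mem_range.mp hk)
    have hcross : ∫ ω, M ω * (H T ω * m T ω) ∂P = 0 := by
      have hint : Integrable (fun ω => M ω * (H T ω * m T ω)) P := ih1.integrable_mul hHmT
      have h1 : P[(fun ω => M ω * H T ω) * m T | 𝓖 T] =ᵐ[P] (fun ω => M ω * H T ω) * P[m T | 𝓖 T] :=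
        condExp_mul_of_stronglyMeasurable_left (hMm.mul (hH T hT)).stronglyMeasurable
          (hint.congr (ae_of_all _ fun ω => by simp [mul_assoc]))
          ((hm T hT).integrable (by norm_num))
      have h2 : ∫ ω, ((fun ω => M ω * H T ω) * m T) ω ∂P = 0 := by
        rw [← integral_condExp (h𝓖 T)]
        rw [integral_congr_ae (g := fun _ => (0 : ℝ)), integral_zero]
        filter_upwards [h1, hm0 T hT] with ω h h'
        rw [h, Pi.mul_apply, h']; simp
      rw [← h2]
      exact integral_congr_ae (ae_of_all _ fun ω => by simp [mul_assoc])
    have hsum : ∀ ω, ∑ s ∈ Finset.range (T + 1), H s ω * m s ω = M ω + H T ω * m T ω := fun ω => by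
      rw [Finset.sum_range_succ]
    simp only [hsum]
    refine ⟨ih1.add hHmT, ?_⟩
    have hsq : ∫ ω, (H T ω * m T ω) ^ 2 ∂P ≤ κ T ^ 2 * ν := by
      calc ∫ ω, (H T ω * m T ω) ^ 2 ∂P ≤ ∫ ω, κ T ^ 2 * m T ω ^ 2 ∂P := by
            refine integral_mono_ae hHmT.integrable_sq ((hm T hT).integrable_sq.const_mul _) ?_
            filter_upwards [hκ T hT] with ω hω
            simp only [mul_pow]
            exact mul_le_mul_of_nonneg_right (sq_le_sq' (abs_le.mp hω).1 (abs_le.mp hω).2)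
              (sq_nonneg _)
        _ = κ T ^ 2 * ∫ ω, m T ω ^ 2 ∂P := integral_const_mul _ _
        _ ≤ κ T ^ 2 * ν := mul_le_mul_of_nonneg_left (hν T hT) (sq_nonneg _)
    have hexp : ∫ ω, (M ω + H T ω * m T ω) ^ 2 ∂P
        = ∫ ω, M ω ^ 2 ∂P + 2 * ∫ ω, M ω * (H T ω * m T ω) ∂P
          + ∫ ω, (H T ω * m T ω) ^ 2 ∂P := by
      have hint : Integrable (fun ω => M ω * (H T ω * m T ω)) P := ih1.integrable_mul hHmT
      have hint' : Integrable (fun ω => M ω ^ 2 + 2 * (M ω * (H T ω * m T ω))) P :=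
        ih1.integrable_sq.add (hint.const_mul 2)
      rw [← integral_const_mul, ← integral_add ih1.integrable_sq (hint.const_mul 2),
        ← integral_add hint' hHmT.integrable_sq]
      exact integral_congr_ae (ae_of_all _ fun ω => by ring)
    rw [hexp, hcross, Finset.sum_range_succ, mul_add]
    linarith

namespace IsAveraged

variable {ℱ : Filtration ℕ mΩ} {τ : ℝ → ℕ} {b : ℝ} {g : ℕ → Ω → ℝ}

lemma integrable (hg : IsAveraged P ℱ τ b g) (t : ℕ) : Integrable (g t) P :=
  memLp_one_iff_integrable.mp (memLp_of_ae_abs_le (hg.measurable t) (hg.bounded t) 1)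

lemma nonneg (hg : IsAveraged P ℱ τ b g) : 0 ≤ b := by
  obtain ⟨ω, hω⟩ := (hg.bounded 0).exists
  exact (abs_nonneg _).trans hω

/-- Conditional sums over windows of arbitrary length `m` grow at most logarithmically: a window of
length `m` contains an initial piece of length `τ ε`, with `ε` of order `1 / m`, whose contribution
is bounded, and the rest is shorter than `m` by a constant factor. -/
lemma condExp_window_le (hg : IsAveraged P ℱ τ b g) :
    ∃ C : ℝ, 0 ≤ C ∧ ∀ m : ℕ, 1 ≤ m → ∀ t : ℕ, 1 ≤ t → ∀ᵐ ω ∂P,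
      |(P[fun ω' => ∑ k ∈ Finset.range m, g (t + k) ω' | ℱ t]) ω| ≤ C * (1 + Real.log m) := by
  obtain ⟨c, hc, hlow⟩ := hg.lower
  obtain ⟨c', hup⟩ := hg.upper
  have hb := hg.nonneg
  have hcc : c ≤ c' := by
    have h1 := hlow 1 one_pos
    have h2 := hup 1 one_pos le_rfl
    simp only [div_one] at h1 h2
    exact h1.trans h2
  have hc' : 0 < c' := hc.trans_le hcc
  set ρ := c / c' with hρ
  have hρ0 : 0 < ρ := div_pos hc hc'
  have hρ1 : ρ ≤ 1 := (div_le_one hc').mpr hcc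
  set B := c' * (b + 1) with hB
  set K := c' / ρ with hK
  have hB0 : 0 ≤ B := by positivity
  have hK0 : 0 ≤ K := by positivity
  have key : ∀ m : ℕ, 1 ≤ m → ∀ t : ℕ, 1 ≤ t → ∀ᵐ ω ∂P,
      |(P[fun ω' => ∑ k ∈ Finset.range m, g (t + k) ω' | ℱ t]) ω| ≤ B + K * Real.log m := by
    intro m
    induction m using Nat.strong_induction_on with
    | _ m ih =>
    intro hm t ht
    have hm1 : (1 : ℝ) ≤ m := Nat.one_le_cast.mpr hm
    have hlogm : 0 ≤ Real.log m := Real.log_nonneg hm1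
    by_cases hmc : (m : ℝ) ≤ c'
    · refine ae_bdd_abs_condExp_of_ae_bdd_abs ?_
      filter_upwards [ae_all_iff.mpr hg.bounded] with ω hω
      calc |∑ k ∈ Finset.range m, g (t + k) ω| ≤ ∑ k ∈ Finset.range m, |g (t + k) ω| :=
            Finset.abs_sum_le_sum_abs _ _
        _ ≤ ∑ k ∈ Finset.range m, b := Finset.sum_le_sum fun k _ => hω _
        _ = m * b := by simp
        _ ≤ B + K * Real.log m := by
          have h1 : m * b ≤ c' * b := mul_le_mul_of_nonneg_right hmc hb
          have h2 := mul_nonneg hK0 hlogm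
          have h3 : B = c' * b + c' := by rw [hB]; ring
          linarith
    · push Not at hmc
      set ε := c' / m with hε
      have hm0 : (0 : ℝ) < m := by linarith
      have hε0 : 0 < ε := div_pos hc' hm0
      have hε1 : ε ≤ 1 := (div_le_one hm0).mpr hmc.le
      set n := τ ε with hn
      have hnm : n ≤ m := by
        have h := hup ε hε0 hε1
        have e : c' / ε = m := by rw [hε]; field_simp
        rw [e] at h
        exact_mod_cast h
      have hnρ : ρ * m ≤ n := by
        have h := hlow ε hε0
        have e : c / ε = ρ * m := by rw [hε, hρ]; field_simp
        rwa [e] at h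
      have hn0 : (0 : ℝ) < n := lt_of_lt_of_le (by positivity) hnρ
      have hn1 : 1 ≤ n := by exact_mod_cast hn0
      -- the initial piece contributes at most `n ε ≤ m ε`, which is `c'` by the choice of `ε`
      have hfirst : ∀ᵐ ω ∂P,
          |(P[fun ω' => ∑ k ∈ Finset.range n, g (t + k) ω' | ℱ t]) ω| ≤ c' := by
        have e : (fun ω' => ∑ k ∈ Finset.range n, g (t + k) ω')
            = (n : ℝ) • fun ω' => (1 / (n : ℝ)) * ∑ k ∈ Finset.range n, g (t + k) ω' := by
          ext ω'; simp only [Pi.smul_apply, smul_eq_mul]; field_simp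
        rw [e]
        filter_upwards [hg.averaging ε hε0 t ht,
          condExp_smul (μ := P) (n : ℝ)
            (fun ω' => (1 / (n : ℝ)) * ∑ k ∈ Finset.range n, g (t + k) ω') (ℱ t)] with ω h1 h2
        rw [h2, Pi.smul_apply, smul_eq_mul, abs_mul, abs_of_pos hn0]
        calc (n : ℝ) * _ ≤ m * ε :=
              mul_le_mul (Nat.cast_le.mpr hnm) h1 (abs_nonneg _) hm0.le
          _ = c' := by rw [hε]; field_simp
      have hsplit : (fun ω' => ∑ k ∈ Finset.range m, g (t + k) ω')
          = (fun ω' => ∑ k ∈ Finset.range n, g (t + k) ω')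
            + fun ω' => ∑ k ∈ Finset.range (m - n), g (t + n + k) ω' := by
        ext ω'
        have : m = n + (m - n) := by omega
        conv_lhs => rw [this, Finset.sum_range_add]
        simp [add_assoc]
      have hint : ∀ (t n : ℕ), Integrable (fun ω' => ∑ k ∈ Finset.range n, g (t + k) ω') P :=
        fun t n => integrable_finsetSum _ fun k _ => hg.integrable _
      rw [hsplit]
      have hadd := condExp_add (hint t n) (hint (t + n) (m - n)) (ℱ t)
      rcases Nat.eq_zero_or_pos (m - n) with h0 | h0
      · filter_upwards [hfirst, hadd] with ω h1 h2
        rw [h2, Pi.add_apply, h0]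
        have : (P[fun ω' => ∑ k ∈ Finset.range 0, g (t + n + k) ω' | ℱ t]) = 0 := by
          simp only [Finset.range_zero, Finset.sum_empty]
          exact condExp_zero
        rw [this, Pi.zero_apply, add_zero]
        have h3 : B = c' * b + c' := by rw [hB]; ring
        have h4 := mul_nonneg hK0 hlogm
        have h5 := mul_nonneg hc'.le hb
        linarith
      · have hih := ih (m - n) (by omega) h0 (t + n) (by omega)
        have htower := condExp_condExp_of_le (μ := P) (ℱ.mono (Nat.le_add_right t n)) (ℱ.le (t + n))
          (f := fun ω' => ∑ k ∈ Finset.range (m - n), g (t + n + k) ω')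
        filter_upwards [hfirst, hadd, htower,
          ae_bdd_abs_condExp_of_ae_bdd_abs (m := ℱ t) hih] with ω h1 h2 h3 h4
        rw [h2, Pi.add_apply, ← h3]
        refine (abs_add_le _ _).trans ?_
        have hmn : ((m - n : ℕ) : ℝ) = m - n := by push_cast [hnm]; ring
        have hpos : (0 : ℝ) < ((m - n : ℕ) : ℝ) := Nat.cast_pos.mpr h0
        -- `log (m - n) ≤ log m - ρ`, as `m - n ≤ (1 - ρ) m`
        have hlog : Real.log ((m - n : ℕ) : ℝ) ≤ Real.log m - ρ := by
          have e : ((m - n : ℕ) : ℝ) = (((m - n : ℕ) : ℝ) / m) * m := by field_simp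
          rw [e, Real.log_mul (by positivity) (by positivity)]
          have h5 := Real.log_le_sub_one_of_pos (x := ((m - n : ℕ) : ℝ) / m) (by positivity)
          have h6 : ((m - n : ℕ) : ℝ) / m ≤ 1 - ρ := by
            rw [div_le_iff₀ hm0, hmn]; linarith
          linarith
        have h7 : K * Real.log ((m - n : ℕ) : ℝ) ≤ K * Real.log m - c' := by
          have := mul_le_mul_of_nonneg_left hlog hK0
          have e : K * ρ = c' := by rw [hK]; field_simp
          linarith
        linarith
  refine ⟨B + K, by positivity, fun m hm t ht => ?_⟩
  filter_upwards [key m hm t ht] with ω hω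
  refine hω.trans ?_
  have hlogm : 0 ≤ Real.log m := Real.log_nonneg (Nat.one_le_cast.mpr hm)
  nlinarith [mul_nonneg hB0 hlogm]

lemma futureSum_eq (hg : IsAveraged P ℱ τ b g) {T s : ℕ} (hs : s < T) :
    futureSum P ℱ g T s =ᵐ[P] P[g s | ℱ s] + P[futureSum P ℱ g T (s + 1) | ℱ s] := by
  have e : (fun ω => ∑ k ∈ Finset.Ico s T, g k ω)
      = g s + fun ω => ∑ k ∈ Finset.Ico (s + 1) T, g k ω := by
    ext ω; rw [Finset.sum_eq_sum_Ico_succ_bot hs]; rfl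
  have htower := condExp_condExp_of_le (μ := P) (ℱ.mono (Nat.le_succ s)) (ℱ.le (s + 1))
    (f := fun ω' => ∑ k ∈ Finset.Ico (s + 1) T, g k ω')
  have hadd := condExp_add (hg.integrable s)
    (integrable_finsetSum (Finset.Ico (s + 1) T) fun k _ => hg.integrable k) (ℱ s)
  rw [futureSum, e]
  refine hadd.trans ?_
  filter_upwards [htower] with ω h
  rw [Pi.add_apply, Pi.add_apply, ← h]
  rfl

lemma abs_futureSum_le (hg : IsAveraged P ℱ τ b g) :
    ∃ C : ℝ, 0 ≤ C ∧ ∀ T : ℕ, 1 ≤ T → ∀ s ≤ T, ∀ᵐ ω ∂P,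
      |futureSum P ℱ g T s ω| ≤ C * (1 + Real.log T) := by
  obtain ⟨C, hC, hwin⟩ := hg.condExp_window_le
  have hb := hg.nonneg
  have hpos : ∀ T : ℕ, 1 ≤ T → ∀ s ≤ T, 1 ≤ s → ∀ᵐ ω ∂P,
      |futureSum P ℱ g T s ω| ≤ C * (1 + Real.log T) := by
    intro T hT s hs hs1
    have hlogT : 0 ≤ Real.log T := Real.log_nonneg (Nat.one_le_cast.mpr hT)
    rcases Nat.eq_or_lt_of_le hs with rfl | hlt
    · have : futureSum P ℱ g s s = 0 := by
        simp only [futureSum, Finset.Ico_self, Finset.sum_empty]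
        exact condExp_zero
      rw [this]
      exact ae_of_all _ fun ω => by simp only [Pi.zero_apply, abs_zero]; positivity
    · have e : (fun ω => ∑ k ∈ Finset.Ico s T, g k ω)
          = fun ω => ∑ k ∈ Finset.range (T - s), g (s + k) ω := by
        ext ω; rw [Finset.sum_Ico_eq_sum_range]
      rw [futureSum, e]
      filter_upwards [hwin (T - s) (by omega) s hs1] with ω hω
      refine hω.trans ?_
      have : Real.log ((T - s : ℕ) : ℝ) ≤ Real.log T :=
        Real.log_le_log (Nat.cast_pos.mpr (by omega)) (Nat.cast_le.mpr (Nat.sub_le _ _))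
      gcongr
  refine ⟨C + b, by positivity, fun T hT s hs => ?_⟩
  have hlogT : 0 ≤ Real.log T := Real.log_nonneg (Nat.one_le_cast.mpr hT)
  have hbl := mul_nonneg hb hlogT
  rcases Nat.eq_zero_or_pos s with rfl | hs1
  · -- the averaging assumption starts at time `1`; time `0` is one step away from it
    filter_upwards [hg.futureSum_eq (s := 0) (T := T) hT,
      ae_bdd_abs_condExp_of_ae_bdd_abs (m := ℱ 0) (hg.bounded 0),
      ae_bdd_abs_condExp_of_ae_bdd_abs (m := ℱ 0) (hpos T hT 1 hT le_rfl)] with ω h1 h2 h3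
    rw [h1, Pi.add_apply]
    refine (abs_add_le _ _).trans ?_
    linarith
  · filter_upwards [hpos T hT s hs hs1] with ω hω
    linarith

lemma sum_mul_sub_eq (G V : ℕ → ℝ) (T : ℕ) :
    ∑ s ∈ Finset.range T, G s * (V s - V (s + 1))
      = G 0 * V 0 - G T * V T + ∑ s ∈ Finset.range T, (G (s + 1) - G s) * V (s + 1) := by
  induction T with
  | zero => simp
  | succ T ih => rw [Finset.sum_range_succ, Finset.sum_range_succ, ih]; ring

/-- Weighted sums of an averaged process, with adapted weights of size `1 / √s` and increments of
size `1 / s`, have second moments of logarithmic growth only. The process is a martingale increment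
plus an increment of its expected future sum; the latter is summed by parts. -/
lemma integral_sq_weighted_sum_le (hg : IsAveraged P ℱ τ b g) {κ : ℝ} (hκ : 0 ≤ κ) :
    ∃ K : ℝ, 0 ≤ K ∧ ∀ G : ℕ → Ω → ℝ, (∀ s, Measurable[ℱ s] (G s)) →
      (∀ s : ℕ, ∀ᵐ ω ∂P, G s ω ^ 2 ≤ κ / (s + 1)) →
      (∀ s : ℕ, ∀ᵐ ω ∂P, |G (s + 1) ω - G s ω| ≤ κ / (s + 1)) → ∀ T : ℕ, 1 ≤ T →
        MemLp (fun ω => ∑ s ∈ Finset.range T, G s ω * g s ω) 2 P ∧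
        ∫ ω, (∑ s ∈ Finset.range T, G s ω * g s ω) ^ 2 ∂P ≤ K * (1 + Real.log T) ^ 4 := by
  obtain ⟨C, hC, hV⟩ := hg.abs_futureSum_le
  have hb := hg.nonneg
  refine ⟨2 * ((b + 2 * C) ^ 2 * κ) + 2 * (C * (2 + 3 * κ)) ^ 2, by positivity,
    fun G hG hG2 hGd T hT => ?_⟩
  have hlogT : 0 ≤ Real.log T := Real.log_nonneg (Nat.one_le_cast.mpr hT)
  set L := 1 + Real.log T with hL
  have hL1 : 1 ≤ L := by linarith
  set V := futureSum P ℱ g T with hVdef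
  have hVm : ∀ s, Measurable[ℱ s] (V s) := fun s => measurable_futureSum T s
  have hVm' : ∀ s, Measurable (V s) := fun s => (hVm s).mono (ℱ.le s) le_rfl
  have hGm' : ∀ s, Measurable (G s) := fun s => (hG s).mono (ℱ.le s) le_rfl
  set m : ℕ → Ω → ℝ := fun s ω => g s ω + V (s + 1) ω - V s ω with hm
  have hmm : ∀ s, Measurable[ℱ (s + 1)] (m s) := fun s =>
    ((hg.adapted s).add (hVm (s + 1))).sub ((hVm s).mono (ℱ.mono (Nat.le_succ s)) le_rfl)
  have hmm' : ∀ s, Measurable (m s) := fun s => (hmm s).mono (ℱ.le _) le_rfl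
  have hmb : ∀ s < T, ∀ᵐ ω ∂P, |m s ω| ≤ (b + 2 * C) * L := by
    intro s hs
    filter_upwards [hg.bounded s, hV T hT s hs.le, hV T hT (s + 1) hs] with ω h1 h2 h3
    have h4 : |m s ω| ≤ |g s ω| + |V (s + 1) ω| + |V s ω| :=
      (abs_sub _ _).trans (add_le_add_left (abs_add_le _ _) _)
    nlinarith
  have hm0 : ∀ s < T, P[m s | ℱ s] =ᵐ[P] 0 := by
    intro s hs
    have hVi : ∀ s, Integrable (V s) P := fun s => integrable_condExp
    have h1 := condExp_sub (((hg.integrable s).add (hVi (s + 1)))) (hVi s) (ℱ s)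
    have h2 := condExp_add (hg.integrable s) (hVi (s + 1)) (ℱ s)
    have h3 : P[V s | ℱ s] = V s :=
      condExp_of_stronglyMeasurable (ℱ.le s) (hVm s).stronglyMeasurable (hVi s)
    filter_upwards [h1, h2, hg.futureSum_eq hs] with ω e1 e2 e3
    have e0 : (P[m s | ℱ s]) ω = (P[g s + V (s + 1) - V s | ℱ s]) ω := rfl
    rw [e0, e1, Pi.sub_apply, e2, h3, hVdef, e3]
    simp
  have hmart := integral_sq_martingale_transform_le (P := P) (𝓖 := fun s => ℱ s)
    (fun s => ℱ.le s) (H := G) (m := m) (κ := fun s => Real.sqrt (κ / (s + 1)))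
    (ν := ((b + 2 * C) * L) ^ 2) (T := T) (fun s _ => hG s)
    (fun s _ k hk => ((hG k).mono (ℱ.mono hk.le) le_rfl).mul ((hmm k).mono (ℱ.mono hk) le_rfl))
    (fun s hs => memLp_of_ae_abs_le (hmm' s) (hmb s hs) 2) hm0
    (fun s _ => (hG2 s).mono fun ω hω => Real.abs_le_sqrt hω)
    (fun s hs => integral_sq_le_of_ae_abs_le (hmm' s) (hmb s hs))
  set M1 : Ω → ℝ := fun ω => ∑ s ∈ Finset.range T, G s ω * m s ω with hM1
  set M2 : Ω → ℝ := fun ω => ∑ s ∈ Finset.range T, G s ω * (V s ω - V (s + 1) ω) with hM2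
  have hdecomp : ∀ ω, ∑ s ∈ Finset.range T, G s ω * g s ω = M1 ω + M2 ω := fun ω => by
    rw [hM1, hM2, ← Finset.sum_add_distrib]
    exact Finset.sum_congr rfl fun s _ => by simp only [hm]; ring
  have hM2m : Measurable M2 :=
    Finset.measurable_fun_sum _ fun s _ => (hGm' s).mul ((hVm' s).sub (hVm' (s + 1)))
  have hM2b : ∀ᵐ ω ∂P, |M2 ω| ≤ C * (2 + 3 * κ) * L ^ 2 := by
    have hVall : ∀ᵐ ω ∂P, ∀ s, s ≤ T → |V s ω| ≤ C * L :=
      ae_all_iff.mpr fun s => by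
        by_cases hs : s ≤ T
        · filter_upwards [hV T hT s hs] with ω hω _ using hω
        · exact ae_of_all _ fun ω h => absurd h hs
    filter_upwards [hVall, ae_all_iff.mpr hG2, ae_all_iff.mpr hGd] with ω h1 h2 h3
    have hG1 : ∀ s, |G s ω| ≤ 1 + κ := fun s => by
      have hle : G s ω ^ 2 ≤ κ := (h2 s).trans (div_le_self hκ (by
        have : (0 : ℝ) ≤ s := Nat.cast_nonneg s
        linarith))
      refine abs_le_of_sq_le_sq ?_ (by linarith)
      nlinarith
    have hCL : 0 ≤ C * L := by positivity
    simp only [hM2]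
    rw [sum_mul_sub_eq (fun s => G s ω) (fun s => V s ω)]
    have hsum : |∑ s ∈ Finset.range T, (G (s + 1) ω - G s ω) * V (s + 1) ω|
        ≤ κ * (C * L) * L := by
      calc _ ≤ ∑ s ∈ Finset.range T, |(G (s + 1) ω - G s ω) * V (s + 1) ω| :=
            Finset.abs_sum_le_sum_abs _ _
        _ ≤ ∑ s ∈ Finset.range T, κ * (C * L) * (1 / ((s : ℝ) + 1)) := by
            refine Finset.sum_le_sum fun s hs => ?_
            rw [abs_mul]
            calc _ ≤ κ / (s + 1) * (C * L) :=
                  mul_le_mul (h3 s) (h1 (s + 1) (Finset.mem_range.mp hs)) (abs_nonneg _)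
                    (by positivity)
              _ = _ := by ring
        _ ≤ κ * (C * L) * L := by
            rw [← Finset.mul_sum]
            exact mul_le_mul_of_nonneg_left (sum_inv_le_one_add_log T) (by positivity)
    have hbd : ∀ s ≤ T, |G s ω * V s ω| ≤ (1 + κ) * (C * L) := fun s hs => by
      rw [abs_mul]; exact mul_le_mul (hG1 s) (h1 s hs) (abs_nonneg _) (by linarith)
    have h4 : (1 + κ) * (C * L) ≤ (1 + κ) * (C * L) * L :=
      le_mul_of_one_le_right (by positivity) hL1
    calc _ ≤ |G 0 ω * V 0 ω - G T ω * V T ω| + _ := abs_add_le _ _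
      _ ≤ |G 0 ω * V 0 ω| + |G T ω * V T ω| + _ := add_le_add_left (abs_sub _ _) _
      _ ≤ (1 + κ) * (C * L) * L + (1 + κ) * (C * L) * L + κ * (C * L) * L :=
        add_le_add (add_le_add ((hbd 0 (Nat.zero_le _)).trans h4) ((hbd T le_rfl).trans h4)) hsum
      _ = _ := by ring
  have hM2L := memLp_of_ae_abs_le (P := P) hM2m hM2b 2
  simp only [hdecomp]
  refine ⟨hmart.1.add hM2L, ?_⟩
  have hsumκ : ∑ s ∈ Finset.range T, Real.sqrt (κ / (s + 1)) ^ 2 ≤ κ * L := by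
    calc _ = κ * ∑ s ∈ Finset.range T, 1 / ((s : ℝ) + 1) := by
          rw [Finset.mul_sum]
          refine Finset.sum_congr rfl fun s _ => ?_
          rw [Real.sq_sqrt (by positivity)]; ring
      _ ≤ κ * L := mul_le_mul_of_nonneg_left (sum_inv_le_one_add_log T) hκ
  have h1 : ∫ ω, M1 ω ^ 2 ∂P ≤ (b + 2 * C) ^ 2 * κ * L ^ 4 := by
    refine hmart.2.trans ?_
    calc _ ≤ ((b + 2 * C) * L) ^ 2 * (κ * L) := mul_le_mul_of_nonneg_left hsumκ (sq_nonneg _)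
      _ = (b + 2 * C) ^ 2 * κ * L ^ 3 := by ring
      _ ≤ _ := mul_le_mul_of_nonneg_left (pow_le_pow_right₀ hL1 (by norm_num)) (by positivity)
  have h2 : ∫ ω, M2 ω ^ 2 ∂P ≤ (C * (2 + 3 * κ)) ^ 2 * L ^ 4 := by
    refine (integral_sq_le_of_ae_abs_le hM2m hM2b).trans (le_of_eq (by ring))
  calc ∫ ω, (M1 ω + M2 ω) ^ 2 ∂P ≤ ∫ ω, (2 * M1 ω ^ 2 + 2 * M2 ω ^ 2) ∂P := by
        refine integral_mono (hmart.1.add hM2L).integrable_sq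
          ((hmart.1.integrable_sq.const_mul 2).add (hM2L.integrable_sq.const_mul 2)) fun ω => ?_
        nlinarith [sq_nonneg (M1 ω - M2 ω)]
    _ = 2 * ∫ ω, M1 ω ^ 2 ∂P + 2 * ∫ ω, M2 ω ^ 2 ∂P := by
        rw [integral_add (hmart.1.integrable_sq.const_mul 2) (hM2L.integrable_sq.const_mul 2),
          integral_const_mul, integral_const_mul]
    _ ≤ _ := by linarith

end IsAveraged

end Probability

/-! ### Random matrices with measurable entries -/

section Measurability

variable {Ω : Type*} {k l n : ℕ}

/-- Measurability of a random matrix with respect to a σ-algebra, entry by entry (Mathlib puts no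
σ-algebra on matrices). -/
def MeasurableEntries (m : MeasurableSpace Ω) (M : Ω → Matrix (Fin k) (Fin l) ℝ) : Prop :=
  ∀ i j, Measurable[m] fun ω => M ω i j

namespace MeasurableEntries

variable {m m' : MeasurableSpace Ω} {M : Ω → Matrix (Fin k) (Fin l) ℝ}

lemma mono (hM : MeasurableEntries m M) (h : m ≤ m') : MeasurableEntries m' M :=
  fun i j => (hM i j).mono h le_rfl

lemma const (A : Matrix (Fin k) (Fin l) ℝ) : MeasurableEntries m fun _ : Ω => A :=
  fun _ _ => measurable_const

lemma add {N : Ω → Matrix (Fin k) (Fin l) ℝ} (hM : MeasurableEntries m M)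
    (hN : MeasurableEntries m N) : MeasurableEntries m fun ω => M ω + N ω :=
  fun i j => (hM i j).add (hN i j)

lemma sub {N : Ω → Matrix (Fin k) (Fin l) ℝ} (hM : MeasurableEntries m M)
    (hN : MeasurableEntries m N) : MeasurableEntries m fun ω => M ω - N ω :=
  fun i j => (hM i j).sub (hN i j)

lemma const_smul (hM : MeasurableEntries m M) (c : ℝ) : MeasurableEntries m fun ω => c • M ω :=
  fun i j => (hM i j).const_mul c

lemma transpose (hM : MeasurableEntries m M) : MeasurableEntries m fun ω => (M ω)ᵀ :=
  fun i j => hM j i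

lemma mul {N : Ω → Matrix (Fin l) (Fin n) ℝ} (hM : MeasurableEntries m M)
    (hN : MeasurableEntries m N) : MeasurableEntries m fun ω => M ω * N ω := fun i j => by
  simp only [Matrix.mul_apply]
  exact Finset.measurable_fun_sum _ fun a _ => (hM i a).mul (hN a j)

lemma mulVec {v : Ω → Fin l → ℝ} (hM : MeasurableEntries m M)
    (hv : ∀ j, Measurable[m] fun ω => v ω j) (i : Fin k) :
    Measurable[m] fun ω => (M ω *ᵥ v ω) i := by
  simp only [Matrix.mulVec, dotProduct]
  exact Finset.measurable_fun_sum _ fun a _ => (hM i a).mul (hv a)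

lemma inv {M : Ω → Matrix (Fin n) (Fin n) ℝ} (hM : MeasurableEntries m M) :
    MeasurableEntries m fun ω => (M ω)⁻¹ := by
  have hpi : Measurable[m] fun ω => (fun i j => M ω i j : Fin n → Fin n → ℝ) :=
    measurable_pi_iff.mpr fun i => measurable_pi_iff.mpr fun j => hM i j
  have hdet : Measurable[m] fun ω => (M ω).det := by
    have hc : Continuous fun N : Fin n → Fin n → ℝ => Matrix.det (Matrix.of N) :=
      Continuous.matrix_det continuous_id
    exact hc.measurable.comp hpi
  intro i j
  have hadj : Measurable[m] fun ω => (M ω).adjugate i j := by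
    have hc : Continuous fun N : Fin n → Fin n → ℝ => Matrix.adjugate (Matrix.of N) i j :=
      (Continuous.matrix_adjugate continuous_id).matrix_elem i j
    exact hc.measurable.comp hpi
  simp only [Matrix.inv_def, Ring.inverse_eq_inv', Matrix.smul_apply, smul_eq_mul]
  exact hdet.inv.mul hadj

end MeasurableEntries

end Measurability

/-! ### Second moments of logarithmic growth -/

section Moments

variable {Ω : Type*} [mΩ : MeasurableSpace Ω] {P : Measure Ω}

/-- The sequence `X T` is square-integrable, with second moment of at most the order
`(1 + log T)⁴`. At `T = 0` the value `log 0 = 0` makes this a plain bound. -/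
def HasLogMoments (P : Measure Ω) (X : ℕ → Ω → ℝ) : Prop :=
  (∀ T, MemLp (X T) 2 P) ∧
    ∃ K : ℝ, 0 ≤ K ∧ ∀ T : ℕ, ∫ ω, X T ω ^ 2 ∂P ≤ K * (1 + Real.log T) ^ 4

lemma one_le_one_add_log (T : ℕ) : 1 ≤ 1 + Real.log T := by
  linarith [Real.log_natCast_nonneg T]

namespace HasLogMoments

variable {X Y : ℕ → Ω → ℝ}

lemma add (hX : HasLogMoments P X) (hY : HasLogMoments P Y) :
    HasLogMoments P fun T ω => X T ω + Y T ω := by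
  obtain ⟨hX1, K, hK, hX2⟩ := hX
  obtain ⟨hY1, K', hK', hY2⟩ := hY
  refine ⟨fun T => (hX1 T).add (hY1 T), 2 * K + 2 * K', by positivity, fun T => ?_⟩
  calc ∫ ω, (X T ω + Y T ω) ^ 2 ∂P ≤ ∫ ω, (2 * X T ω ^ 2 + 2 * Y T ω ^ 2) ∂P := by
        refine integral_mono ((hX1 T).add (hY1 T)).integrable_sq
          (((hX1 T).integrable_sq.const_mul 2).add ((hY1 T).integrable_sq.const_mul 2)) fun ω => ?_
        nlinarith [sq_nonneg (X T ω - Y T ω)]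
    _ = 2 * ∫ ω, X T ω ^ 2 ∂P + 2 * ∫ ω, Y T ω ^ 2 ∂P := by
        rw [integral_add ((hX1 T).integrable_sq.const_mul 2) ((hY1 T).integrable_sq.const_mul 2),
          integral_const_mul, integral_const_mul]
    _ ≤ _ := by linarith [hX2 T, hY2 T]

lemma const_mul (hX : HasLogMoments P X) (c : ℝ) : HasLogMoments P fun T ω => c * X T ω := by
  obtain ⟨hX1, K, hK, hX2⟩ := hX
  refine ⟨fun T => (hX1 T).const_mul c, c ^ 2 * K, by positivity, fun T => ?_⟩
  simp only [mul_pow]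
  rw [integral_const_mul, mul_assoc]
  exact mul_le_mul_of_nonneg_left (hX2 T) (sq_nonneg c)

lemma sum {ι : Type*} {X : ι → ℕ → Ω → ℝ} (s : Finset ι) (hX : ∀ i ∈ s, HasLogMoments P (X i)) :
    HasLogMoments P fun T ω => ∑ i ∈ s, X i T ω := by
  classical
  induction s using Finset.induction_on with
  | empty => exact ⟨fun T => by simp, 0, le_rfl, fun T => by simp⟩
  | insert i s hi ih =>
    simp only [Finset.sum_insert hi]
    exact (hX i (Finset.mem_insert_self i s)).add
      (ih fun j hj => hX j (Finset.mem_insert_of_mem hj))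

lemma of_memLp {f : Ω → ℝ} (hf : MemLp f 2 P) : HasLogMoments P fun _ => f := by
  have h0 : 0 ≤ ∫ ω, f ω ^ 2 ∂P := integral_nonneg fun ω => sq_nonneg _
  exact ⟨fun _ => hf, _, h0, fun T =>
    le_mul_of_one_le_right h0 (one_le_pow₀ (one_le_one_add_log T))⟩

variable [IsProbabilityMeasure P]

lemma of_ae_abs_le (hX : ∀ T, Measurable (X T)) {C : ℝ}
    (hC : ∀ T : ℕ, ∀ᵐ ω ∂P, |X T ω| ≤ C * (1 + Real.log T)) : HasLogMoments P X := by
  refine ⟨fun T => memLp_of_ae_abs_le (hX T) (hC T) 2, C ^ 2, sq_nonneg C, fun T => ?_⟩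
  refine (integral_sq_le_of_ae_abs_le (hX T) (hC T)).trans ?_
  rw [mul_pow]
  exact mul_le_mul_of_nonneg_left
    (pow_le_pow_right₀ (one_le_one_add_log T) (by norm_num)) (sq_nonneg C)

/-- Sums with weights of size `1 / s` are bounded pointwise by a harmonic sum. -/
lemma weighted_sum_of_inv {H g : ℕ → Ω → ℝ} {κ b : ℝ} (hκ : 0 ≤ κ) (hH : ∀ s, Measurable (H s))
    (hg : ∀ s, Measurable (g s)) (hHκ : ∀ s : ℕ, ∀ᵐ ω ∂P, |H s ω| ≤ κ / (s + 1))
    (hgb : ∀ s, ∀ᵐ ω ∂P, |g s ω| ≤ b) :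
    HasLogMoments P fun T ω => ∑ s ∈ Finset.range T, H s ω * g s ω := by
  refine of_ae_abs_le (C := κ * b)
    (fun T => Finset.measurable_fun_sum _ fun s _ => (hH s).mul (hg s)) fun T => ?_
  filter_upwards [ae_all_iff.mpr hHκ, ae_all_iff.mpr hgb] with ω h1 h2
  have hb : 0 ≤ b := (abs_nonneg _).trans (h2 0)
  calc _ ≤ ∑ s ∈ Finset.range T, |H s ω * g s ω| := Finset.abs_sum_le_sum_abs _ _
    _ ≤ ∑ s ∈ Finset.range T, κ * b * (1 / ((s : ℝ) + 1)) := by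
        refine Finset.sum_le_sum fun s _ => ?_
        rw [abs_mul]
        calc _ ≤ κ / (s + 1) * b := mul_le_mul (h1 s) (h2 s) (abs_nonneg _) (by positivity)
          _ = _ := by ring
    _ ≤ _ := by
        rw [← Finset.mul_sum]
        exact mul_le_mul_of_nonneg_left (sum_inv_le_one_add_log T) (by positivity)

/-- Sums of an averaged process with weights of size `1 / √s` and increments of size `1 / s`. -/
lemma weighted_sum_of_isAveraged {ℱ : Filtration ℕ mΩ} {τ : ℝ → ℕ} {b κ : ℝ} {G g : ℕ → Ω → ℝ}
    (hg : IsAveraged P ℱ τ b g) (hκ : 0 ≤ κ) (hG : ∀ s, Measurable[ℱ s] (G s))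
    (hG2 : ∀ s : ℕ, ∀ᵐ ω ∂P, G s ω ^ 2 ≤ κ / (s + 1))
    (hGd : ∀ s : ℕ, ∀ᵐ ω ∂P, |G (s + 1) ω - G s ω| ≤ κ / (s + 1)) :
    HasLogMoments P fun T ω => ∑ s ∈ Finset.range T, G s ω * g s ω := by
  obtain ⟨K, hK, h⟩ := hg.integral_sq_weighted_sum_le hκ
  refine ⟨fun T => ?_, K, hK, fun T => ?_⟩ <;> rcases Nat.eq_zero_or_pos T with rfl | hT
  · simp
  · exact (h G hG hG2 hGd T hT).1
  · simpa using hK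
  · exact (h G hG hG2 hGd T hT).2

/-- Martingale transforms with weights of size `1 / √s`. -/
lemma martingale_transform {𝓖 : ℕ → MeasurableSpace Ω} (h𝓖 : ∀ s, 𝓖 s ≤ mΩ) {H m : ℕ → Ω → ℝ}
    {κ ν : ℝ} (hκ : 0 ≤ κ) (hν : 0 ≤ ν) (hH : ∀ s, Measurable[𝓖 s] (H s))
    (hHm : ∀ s, ∀ k < s, Measurable[𝓖 s] (fun ω => H k ω * m k ω))
    (hm : ∀ s, MemLp (m s) 2 P) (hm0 : ∀ s, P[m s | 𝓖 s] =ᵐ[P] 0)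
    (hHκ : ∀ s : ℕ, ∀ᵐ ω ∂P, H s ω ^ 2 ≤ κ / (s + 1)) (hmν : ∀ s, ∫ ω, m s ω ^ 2 ∂P ≤ ν) :
    HasLogMoments P fun T ω => ∑ s ∈ Finset.range T, H s ω * m s ω := by
  have h := fun T : ℕ => integral_sq_martingale_transform_le (P := P) h𝓖 (H := H) (m := m)
    (κ := fun s => Real.sqrt (κ / (s + 1))) (ν := ν) (T := T) (fun s _ => hH s)
    (fun s _ => hHm s) (fun s _ => hm s) (fun s _ => hm0 s)
    (fun s _ => (hHκ s).mono fun ω hω => Real.abs_le_sqrt hω) (fun s _ => hmν s)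
  refine ⟨fun T => (h T).1, ν * κ, by positivity, fun T => (h T).2.trans ?_⟩
  rw [mul_assoc]
  refine mul_le_mul_of_nonneg_left ?_ hν
  calc _ = κ * ∑ s ∈ Finset.range T, 1 / ((s : ℝ) + 1) := by
        rw [Finset.mul_sum]
        refine Finset.sum_congr rfl fun s _ => ?_
        rw [Real.sq_sqrt (by positivity)]; ring
    _ ≤ κ * (1 + Real.log T) := mul_le_mul_of_nonneg_left (sum_inv_le_one_add_log T) hκ
    _ ≤ _ := mul_le_mul_of_nonneg_left (le_self_pow₀ (one_le_one_add_log T) (by norm_num)) hκ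

end HasLogMoments

end Moments

/-! ### The ensemble and the objective -/

section Ensemble

variable {J p d : ℕ}

lemma step_eq_affine (α h : ℝ) (S : Matrix (Fin p) (Fin d) ℝ) (u : Fin p → ℝ)
    (z : Fin J → Fin d → ℝ) (j : Fin J) :
    step α h S u z j
      = (1 - (h • sampleCov z) * (Sᵀ * S + α • (1 : Matrix (Fin d) (Fin d) ℝ))) *ᵥ z j
        + (h • sampleCov z) *ᵥ (Sᵀ *ᵥ u) := by
  simp only [step, Matrix.sub_mulVec, Matrix.one_mulVec, ← Matrix.mulVec_mulVec, Matrix.add_mulVec,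
    Matrix.smul_mulVec, Matrix.mulVec_sub, Matrix.mulVec_add, Matrix.mulVec_smul, smul_sub,
    smul_add]
  rw [smul_comm α h]
  abel

lemma ensembleMean_affine (hJ : 0 < J) (M : Matrix (Fin d) (Fin d) ℝ) (c : Fin d → ℝ)
    (z : Fin J → Fin d → ℝ) :
    ensembleMean (fun j => M *ᵥ z j + c) = M *ᵥ ensembleMean z + c := by
  have hJ' : (J : ℝ) ≠ 0 := by positivity
  simp only [ensembleMean, Finset.sum_add_distrib, smul_add, Matrix.mulVec_smul, Matrix.mulVec_sum]
  congr 1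
  ext i
  simp [hJ']

lemma deviation_affine (hJ : 0 < J) (M : Matrix (Fin d) (Fin d) ℝ) (c : Fin d → ℝ)
    (z : Fin J → Fin d → ℝ) (j : Fin J) :
    deviation (fun j => M *ᵥ z j + c) j = M *ᵥ deviation z j := by
  rw [deviation, ensembleMean_affine hJ, deviation, Matrix.mulVec_sub]
  abel

lemma sampleCov_affine (hJ : 0 < J) (M : Matrix (Fin d) (Fin d) ℝ) (c : Fin d → ℝ)
    (z : Fin J → Fin d → ℝ) :
    sampleCov (fun j => M *ᵥ z j + c) = M * sampleCov z * Mᵀ := by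
  simp only [sampleCov, deviation_affine hJ, Matrix.mul_smul, Matrix.smul_mul, Matrix.mul_sum,
    Matrix.sum_mul]
  congr 1
  refine Finset.sum_congr rfl fun j _ => ?_
  rw [Matrix.mul_vecMulVec, Matrix.vecMulVec_mul, Matrix.vecMul_transpose]

lemma trace_sampleCov (z : Fin J → Fin d → ℝ) : (sampleCov z).trace = spread z := by
  simp [sampleCov, spread, Matrix.trace_sum, Matrix.trace_vecMulVec]

lemma spread_eq_zero_of_dim (hd : d = 0) (z : Fin J → Fin d → ℝ) : spread z = 0 := by
  subst hd
  simp [spread]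

lemma spread_eq_zero_of_card (hJ : J < 2) (z : Fin J → Fin d → ℝ) : spread z = 0 := by
  interval_cases J
  · simp [spread]
  · simp [spread, deviation, ensembleMean]

lemma measurableEntries_sampleCov {Ω : Type*} {m : MeasurableSpace Ω}
    {z : Ω → Fin J → Fin d → ℝ} (hz : ∀ j i, Measurable[m] fun ω => z ω j i) :
    MeasurableEntries m fun ω => sampleCov (z ω) := by
  intro a b
  have hdev : ∀ j i, Measurable[m] fun ω => deviation (z ω) j i := fun j i => by
    simp only [deviation, ensembleMean, Pi.sub_apply, Pi.smul_apply, Finset.sum_apply, smul_eq_mul]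
    exact (hz j i).sub ((Finset.measurable_fun_sum _ fun k _ => hz k i).const_mul _)
  simp only [sampleCov, Matrix.smul_apply, Matrix.sum_apply, Matrix.vecMulVec_apply, smul_eq_mul]
  exact (Finset.measurable_fun_sum _ fun k _ => (hdev k a).mul (hdev k b)).const_mul _

lemma mulVec_zOpt {A : Matrix (Fin d) (Fin d) ℝ} (hA : A.PosSemidef) {α : ℝ} (hα : 0 < α)
    (zstar : Fin d → ℝ) : A *ᵥ (zOpt A α zstar - zstar) + α • zOpt A α zstar = 0 := by
  have hpd : (A + α • (1 : Matrix (Fin d) (Fin d) ℝ)).PosDef :=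
    (Matrix.PosDef.one.smul hα).posSemidef_add hA
  have hdet : IsUnit (A + α • (1 : Matrix (Fin d) (Fin d) ℝ)).det :=
    (Matrix.isUnit_iff_isUnit_det _).mp hpd.isUnit
  have h : (A + α • (1 : Matrix (Fin d) (Fin d) ℝ)) *ᵥ zOpt A α zstar = A *ᵥ zstar := by
    rw [zOpt, Matrix.mulVec_mulVec, Matrix.mul_nonsing_inv _ hdet, Matrix.one_mulVec]
  rw [Matrix.add_mulVec, Matrix.smul_mulVec, Matrix.one_mulVec] at h
  rw [Matrix.mulVec_sub, ← h]
  abel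

lemma objective_sub_objective_zOpt {A : Matrix (Fin d) (Fin d) ℝ} (hA : A.PosSemidef) {α : ℝ}
    (hα : 0 < α) (zstar z : Fin d → ℝ) :
    objective A α zstar z - objective A α zstar (zOpt A α zstar)
      = 1 / 2 * ((z - zOpt A α zstar) ⬝ᵥ (A *ᵥ (z - zOpt A α zstar)))
        + α / 2 * ((z - zOpt A α zstar) ⬝ᵥ (z - zOpt A α zstar)) := by
  have h0 := mulVec_zOpt hA hα zstar
  set o := zOpt A α zstar with ho
  set x := z - o with hx
  set v := o - zstar with hv
  have hz : z = x + o := by rw [hx]; abel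
  have hzv : x + o - zstar = x + v := by rw [hv]; abel
  have hAt : Aᵀ = A := by
    have := hA.isHermitian.eq
    rwa [Matrix.conjTranspose_eq_transpose_of_trivial] at this
  have hsymm : v ⬝ᵥ (A *ᵥ x) = x ⬝ᵥ (A *ᵥ v) := by
    rw [Matrix.dotProduct_mulVec, ← Matrix.mulVec_transpose, hAt, dotProduct_comm]
  have h1 : x ⬝ᵥ (A *ᵥ v) + α * (x ⬝ᵥ o) = 0 := by
    have := congrArg (fun y => x ⬝ᵥ y) h0
    simpa [dotProduct_add, dotProduct_smul] using this
  have hox : o ⬝ᵥ x = x ⬝ᵥ o := dotProduct_comm _ _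
  simp only [objective]
  rw [hz, hzv, ← hv]
  simp only [Matrix.mulVec_add, dotProduct_add, add_dotProduct, hsymm, hox]
  linarith

lemma objective_sub_objective_zOpt_bounds {A : Matrix (Fin d) (Fin d) ℝ} (hA : A.PosSemidef)
    (hA1 : (1 - A).PosSemidef) {α : ℝ} (hα : 0 < α) (zstar z : Fin d → ℝ) :
    0 ≤ objective A α zstar z - objective A α zstar (zOpt A α zstar) ∧
    objective A α zstar z - objective A α zstar (zOpt A α zstar)
      ≤ (1 + α) / 2 * ((z - zOpt A α zstar) ⬝ᵥ (z - zOpt A α zstar)) := by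
  rw [objective_sub_objective_zOpt hA hα]
  set x := z - zOpt A α zstar
  have h1 : 0 ≤ x ⬝ᵥ (A *ᵥ x) := by simpa using hA.dotProduct_mulVec_nonneg x
  have h2 : 0 ≤ x ⬝ᵥ ((1 - A) *ᵥ x) := by simpa using hA1.dotProduct_mulVec_nonneg x
  rw [Matrix.sub_mulVec, Matrix.one_mulVec, dotProduct_sub] at h2
  have h3 : 0 ≤ x ⬝ᵥ x := by linarith
  constructor
  · positivity
  · linarith

/-- The error of the ensemble mean follows a linear recursion driven by the fluctuation of `SᵀS`
around its average `A` and by the observation noise. -/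
lemma ensembleMean_step_sub_zOpt (hJ : 0 < J) {A : Matrix (Fin d) (Fin d) ℝ} (hA : A.PosSemidef)
    {α : ℝ} (hα : 0 < α) (h : ℝ) (S : Matrix (Fin p) (Fin d) ℝ) (zstar : Fin d → ℝ)
    (w : Fin p → ℝ) (z : Fin J → Fin d → ℝ) :
    ensembleMean (step α h S (S *ᵥ zstar + w) z) - zOpt A α zstar
      = (ensembleMean z - zOpt A α zstar) - (h • sampleCov z) *ᵥ
        ((Sᵀ * S + α • (1 : Matrix (Fin d) (Fin d) ℝ)) *ᵥ (ensembleMean z - zOpt A α zstar)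
          + ((Sᵀ * S - A) *ᵥ (zOpt A α zstar - zstar) - Sᵀ *ᵥ w)) := by
  have h0 := mulVec_zOpt hA hα zstar
  have e : step α h S (S *ᵥ zstar + w) z = _ := funext fun j => step_eq_affine α h S _ z j
  rw [e, ensembleMean_affine hJ]
  set o := zOpt A α zstar
  set c := ensembleMean z
  set B := Sᵀ * S + α • (1 : Matrix (Fin d) (Fin d) ℝ) with hB
  have h1 : B *ᵥ (c - o) + ((Sᵀ * S - A) *ᵥ (o - zstar) - Sᵀ *ᵥ w)
      = B *ᵥ c - Sᵀ *ᵥ (S *ᵥ zstar + w) := by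
    have h2 : A *ᵥ (o - zstar) = -(α • o) := eq_neg_of_add_eq_zero_left h0
    rw [Matrix.sub_mulVec, h2, hB]
    simp only [Matrix.add_mulVec, Matrix.mulVec_sub, Matrix.mulVec_add, Matrix.smul_mulVec,
      Matrix.one_mulVec, ← Matrix.mulVec_mulVec]
    abel
  rw [h1, Matrix.mulVec_sub, Matrix.sub_mulVec, Matrix.one_mulVec, ← Matrix.mulVec_mulVec]
  abel

end Ensemble

/-! ### Trajectories of the ensemble as covariance flows -/

section Flow

variable {J p d : ℕ}

/-- All weights that occur in the forcing terms decay, uniformly over covariance flows. -/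
lemma IsCovarianceFlow.exists_gain_bounds {α β σ : ℝ} (hα : 0 < α) (hαβ : α ≤ β)
    (hσ : 0 < σ) (hd : 0 < d) :
    ∃ κ : ℝ, 0 ≤ κ ∧ ∀ D B : ℕ → Matrix (Fin d) (Fin d) ℝ, IsCovarianceFlow α β σ D B → ∀ t : ℕ,
      ‖gain D B t‖ ^ 2 ≤ κ / (t + 1) ∧
      ‖gain D B (t + 1) - gain D B t‖ ≤ κ / (t + 1) ∧
      ‖gain D B t * resolvent D B t‖ ^ 2 ≤ κ / (t + 1) ∧
      ‖gain D B t * resolvent D B t - gain D B t‖ ≤ κ / (t + 1) := by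
  have hβ : 0 < β := hα.trans_le hαβ
  set k := ((d : ℝ) / α) ^ 2 * (d / α / σ) with hk
  have hk0 : 0 ≤ k := by positivity
  set l := (1 + k) * (β * (d / α)) with hl
  have hl0 : 0 ≤ l := by positivity
  refine ⟨4 * k + 2 * l, by positivity, fun D B hf t => ?_⟩
  have ht : (0 : ℝ) < t + 1 := by positivity
  have hG2 := hf.norm_gain_le hα hαβ hσ hd t
  rw [← hk] at hG2
  have hG1 : ‖gain D B t‖ ≤ 1 + k := by
    have h1 : k / ((t : ℝ) + 1) ≤ k := div_le_self hk0 (by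
      have : (0 : ℝ) ≤ t := Nat.cast_nonneg t
      linarith)
    refine le_of_sq_le_sq ?_ (by linarith)
    nlinarith
  obtain ⟨-, hR, hR2⟩ := hf.resolvent_spec hα hαβ hd t
  have hBD : ‖B t * D t‖ ≤ β * (d / α / (t + 1)) :=
    (Matrix.l2_opNorm_mul _ _).trans (mul_le_mul (hf.norm_le t) (hf.norm_le_inv hα hαβ hd t)
      (norm_nonneg _) hβ.le)
  have hGR : ‖gain D B t * resolvent D B t‖ ≤ ‖gain D B t‖ * 2 :=
    (Matrix.l2_opNorm_mul _ _).trans (mul_le_mul_of_nonneg_left hR2 (norm_nonneg _))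
  refine ⟨hG2.trans ?_, (hf.norm_gain_sub_le hα hαβ hd t).trans ?_, ?_, ?_⟩
  · gcongr; linarith
  · have : ‖gain D B t‖ * (β * (d / α)) ≤ l := mul_le_mul_of_nonneg_right hG1 (by positivity)
    gcongr; linarith
  · calc _ ≤ (‖gain D B t‖ * 2) ^ 2 := by gcongr
      _ = 4 * ‖gain D B t‖ ^ 2 := by ring
      _ ≤ 4 * (k / (t + 1)) := by gcongr
      _ = (4 * k) / (t + 1) := by ring
      _ ≤ _ := by gcongr; linarith
  · have e : gain D B t * resolvent D B t - gain D B t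
        = gain D B t * resolvent D B t * (B t * D t) := by
      have h1 : gain D B t * resolvent D B t * (1 - B t * D t) = gain D B t := by
        rw [Matrix.mul_assoc, hR, Matrix.mul_one]
      rw [Matrix.mul_sub, Matrix.mul_one] at h1
      nth_rewrite 2 [← h1]
      abel
    rw [e]
    calc _ ≤ ‖gain D B t * resolvent D B t‖ * ‖B t * D t‖ := Matrix.l2_opNorm_mul _ _
      _ ≤ (‖gain D B t‖ * 2) * (β * (d / α / (t + 1))) := by gcongr
      _ ≤ ((1 + k) * 2) * (β * (d / α / (t + 1))) := by gcongr
      _ = 2 * l / (t + 1) := by rw [hl]; ring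
      _ ≤ _ := by gcongr; linarith

/-- The step size condition forces a nonzero spread, hence a positive dimension and at least two
particles; it makes the rescaled sample covariances a covariance flow. -/
lemma isCovarianceFlow_ensemble {α h Amax σl : ℝ} (hα : 0 < α) (hh : 0 < h)
    {S : ℕ → Matrix (Fin p) (Fin d) ℝ} {u : ℕ → Fin p → ℝ} {z₀ : Fin J → Fin d → ℝ}
    (hS : ∀ t, ‖(S (t + 1))ᵀ * S (t + 1)‖ ≤ Amax) (hσl : 0 < σl)
    (hC₀ : (sampleCov z₀ - σl • (1 : Matrix (Fin d) (Fin d) ℝ)).PosDef)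
    (hstep : h ≤ min (α / ((J : ℝ) * (Amax + α) ^ 2)) ((J : ℝ) / α) * (spread z₀)⁻¹) :
    0 < d ∧ 0 < J ∧ 0 ≤ Amax ∧ IsCovarianceFlow α (Amax + α) (h * σl)
      (fun t => h • sampleCov (ensemble α h S u z₀ t))
      (fun t => (S (t + 1))ᵀ * S (t + 1) + α • (1 : Matrix (Fin d) (Fin d) ℝ)) := by
  have hsp : spread z₀ ≠ 0 := fun h0 => by
    rw [h0, inv_zero, mul_zero] at hstep
    exact absurd hstep (not_le.mpr hh)
  have hd : 0 < d := Nat.pos_of_ne_zero fun h0 => hsp (spread_eq_zero_of_dim h0 z₀)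
  have hJ2 : 2 ≤ J := not_lt.mp fun h0 => hsp (spread_eq_zero_of_card h0 z₀)
  have hJ : 0 < J := by omega
  have hA : 0 ≤ Amax := (norm_nonneg _).trans (hS 0)
  have hσ : (h • sampleCov z₀ - (h * σl) • (1 : Matrix (Fin d) (Fin d) ℝ)).PosSemidef := by
    rw [mul_smul, ← smul_sub]
    exact hC₀.posSemidef.smul hh.le
  have hpos : (h • sampleCov z₀).PosSemidef := by
    have := hσ.add (Matrix.PosSemidef.one.smul (mul_pos hh hσl).le)
    rwa [sub_add_cancel] at this
  have hsp0 : 0 < spread z₀ := by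
    have h1 := hpos.trace_nonneg
    rw [Matrix.trace_smul, trace_sampleCov, smul_eq_mul] at h1
    exact lt_of_le_of_ne (nonneg_of_mul_nonneg_right h1 hh) hsp.symm
  refine ⟨hd, hJ, hA, hpos, hσ, ?_, fun t => ?_, fun t => ?_, fun t => ?_, fun t => ?_⟩
  · rw [ensemble, Matrix.trace_smul, trace_sampleCov, smul_eq_mul]
    have hJ' : (2 : ℝ) ≤ J := by exact_mod_cast hJ2
    have h1 : h * spread z₀ ≤ α / ((J : ℝ) * (Amax + α) ^ 2) := by
      rw [← div_eq_mul_inv, le_div_iff₀ hsp0] at hstep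
      exact hstep.trans (min_le_left _ _)
    have hβ : 0 < (Amax + α) ^ 2 := by positivity
    calc _ ≤ α / ((J : ℝ) * (Amax + α) ^ 2) * (Amax + α) ^ 2 :=
          mul_le_mul_of_nonneg_right h1 hβ.le
      _ = α / J := by field_simp
      _ ≤ α / 2 := by gcongr
  · have e : ensemble α h S u z₀ (t + 1) = _ :=
      funext fun j => step_eq_affine α h (S (t + 1)) (u (t + 1)) (ensemble α h S u z₀ t) j
    rw [e, sampleCov_affine hJ, Matrix.mul_smul _ h, Matrix.smul_mul h (_ * _)]
  · simp [Matrix.transpose_mul]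
  · rw [add_sub_cancel_right, ← Matrix.conjTranspose_eq_transpose_of_trivial]
    exact Matrix.posSemidef_conjTranspose_mul_self _
  · refine (norm_add_le _ _).trans (add_le_add (hS t) ?_)
    rw [norm_smul, Real.norm_of_nonneg hα.le]
    exact mul_le_of_le_one_right hα.le norm_one_le

end Flow

/-! ### The noise and the averaged operators -/

section Model

variable {Ω : Type*} [mΩ : MeasurableSpace Ω] {P : Measure Ω} {p d : ℕ}
  {ℱ : Filtration ℕ mΩ} {S : ℕ → Ω → Matrix (Fin p) (Fin d) ℝ} {w : ℕ → Ω → Fin p → ℝ}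
  {Γ : Matrix (Fin p) (Fin p) ℝ}

namespace IsObservationModel

/-- The information available before the noise `w (t + 1)` is drawn: the past and the operator
`S (t + 1)`. -/
@[reducible] def preNoise (ℱ : Filtration ℕ mΩ) (S : ℕ → Ω → Matrix (Fin p) (Fin d) ℝ) (t : ℕ) :
    MeasurableSpace Ω :=
  ℱ t ⊔ MeasurableSpace.comap
    (fun ω => (fun i j => S (t + 1) ω i j : Fin p → Fin d → ℝ)) inferInstance

lemma preNoise_le (hm : IsObservationModel P ℱ S w Γ) (t : ℕ) : preNoise ℱ S t ≤ mΩ := by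
  refine sup_le (ℱ.le t) (Measurable.comap_le ?_)
  exact measurable_pi_iff.mpr fun i => measurable_pi_iff.mpr fun j =>
    (hm.operator_adapted t i j).mono (ℱ.le _) le_rfl

lemma measurableEntries_operator (t : ℕ) : MeasurableEntries (preNoise ℱ S t) (S (t + 1)) := by
  intro i j
  have h1 : Measurable[preNoise ℱ S t]
      (fun ω => (fun i j => S (t + 1) ω i j : Fin p → Fin d → ℝ)) :=
    (comap_measurable _).mono le_sup_right le_rfl
  exact (measurable_pi_apply j).comp ((measurable_pi_apply i).comp h1)

lemma measurable_noise (hm : IsObservationModel P ℱ S w Γ) (t : ℕ) (j : Fin p) :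
    Measurable[ℱ (t + 1)] fun ω => w (t + 1) ω j :=
  (measurable_pi_apply j).comp (hm.noise_adapted t)

lemma memLp_noise (hm : IsObservationModel P ℱ S w Γ) (t : ℕ) (j : Fin p) :
    MemLp (fun ω => w (t + 1) ω j) 2 P := by
  have hl := hm.noise_law t
  have h1 : MemLp (fun x : EuclideanSpace ℝ (Fin p) => x j) 2 (multivariateGaussian 0 Γ) :=
    (EuclideanSpace.proj (𝕜 := ℝ) j).comp_memLp' IsGaussian.memLp_two_id
  rw [← hl.map_eq] at h1
  exact (memLp_map_measure_iff h1.1 hl.aemeasurable).mp h1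

lemma integral_noise (hm : IsObservationModel P ℱ S w Γ) (t : ℕ) (j : Fin p) :
    ∫ ω, w (t + 1) ω j ∂P = 0 := by
  have hl := hm.noise_law t
  have h1 : ∫ ω, w (t + 1) ω j ∂P
      = ∫ x : EuclideanSpace ℝ (Fin p), x j ∂(multivariateGaussian 0 Γ) :=
    hl.integral_comp (f := fun x : EuclideanSpace ℝ (Fin p) => x j)
      (EuclideanSpace.proj (𝕜 := ℝ) j).continuous.aestronglyMeasurable
  have h2 := (EuclideanSpace.proj (𝕜 := ℝ) j).integral_comp_comm
    (μ := multivariateGaussian (0 : EuclideanSpace ℝ (Fin p)) Γ) (φ := id)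
    (IsGaussian.memLp_two_id.integrable (by norm_num))
  rw [h1]
  refine h2.trans ?_
  simp

lemma integral_noise_sq (hm : IsObservationModel P ℱ S w Γ) (t : ℕ) (j : Fin p) :
    ∫ ω, w (t + 1) ω j ^ 2 ∂P
      = ∫ x : EuclideanSpace ℝ (Fin p), x j ^ 2 ∂(multivariateGaussian 0 Γ) :=
  (hm.noise_law t).integral_comp (f := fun x : EuclideanSpace ℝ (Fin p) => x j ^ 2)
    ((EuclideanSpace.proj (𝕜 := ℝ) j).continuous.pow 2).aestronglyMeasurable

lemma condExp_noise [IsProbabilityMeasure P] (hm : IsObservationModel P ℱ S w Γ) (t : ℕ)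
    (j : Fin p) :
    P[fun ω => w (t + 1) ω j | preNoise ℱ S t] =ᵐ[P] 0 := by
  have hle : MeasurableSpace.comap (w (t + 1)) inferInstance ≤ mΩ :=
    Measurable.comap_le ((hm.noise_adapted t).mono (ℱ.le _) le_rfl)
  have hj : Measurable[MeasurableSpace.comap (w (t + 1)) inferInstance]
      fun ω => w (t + 1) ω j :=
    (measurable_pi_apply j).comp (comap_measurable (w (t + 1)))
  have h := condExp_indep_eq hle (hm.preNoise_le t) hj.stronglyMeasurable (hm.noise_indep t)
  filter_upwards [h] with ω hω
  rw [hω, hm.integral_noise t j, Pi.zero_apply]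

end IsObservationModel

lemma IsPeriodicAveraging.isAveraged [IsProbabilityMeasure P] {A : Matrix (Fin d) (Fin d) ℝ}
    {τ : ℝ → ℕ} {Amax : ℝ}
    (hper : IsPeriodicAveraging P ℱ S A τ) (hm : IsObservationModel P ℱ S w Γ)
    (hAmax : ∀ t : ℕ, ∀ᵐ ω ∂P, ‖(S (t + 1) ω)ᵀ * S (t + 1) ω‖ ≤ Amax) (a b : Fin d) :
    IsAveraged P ℱ τ (Amax + ‖A‖)
      fun t ω => ((S (t + 1) ω)ᵀ * S (t + 1) ω - A) a b := by
  have hSm : ∀ t, MeasurableEntries (ℱ (t + 1)) fun ω => (S (t + 1) ω)ᵀ * S (t + 1) ω := fun t =>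
    (MeasurableEntries.transpose (hm.operator_adapted t)).mul (hm.operator_adapted t)
  refine ⟨hper.window_lower, hper.window_upper, fun t => ?_, fun t => ?_, fun ε hε t ht => ?_⟩
  · exact ((hSm t).sub (MeasurableEntries.const A)) a b
  · filter_upwards [hAmax t] with ω hω
    exact (abs_entry_le_norm _ a b).trans ((norm_sub_le _ _).trans (by linarith))
  · have hτ : (τ ε : ℝ) ≠ 0 := by
      obtain ⟨c, hc, hlow⟩ := hper.window_lower
      exact ((div_pos hc hε).trans_le (hlow ε hε)).ne'
    set f : Ω → ℝ := fun ω' => ((1 / (τ ε : ℝ)) •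
        ∑ k ∈ Finset.range (τ ε), (S (t + 1 + k) ω')ᵀ * S (t + 1 + k) ω') a b with hf
    have hidx : ∀ k, t + 1 + k = t + k + 1 := fun k => by omega
    have e : (fun ω' => (1 / (τ ε : ℝ)) * ∑ k ∈ Finset.range (τ ε),
        ((S (t + k + 1) ω')ᵀ * S (t + k + 1) ω' - A) a b) = f - fun _ => A a b := by
      ext ω'
      simp only [hf, hidx, Matrix.sub_apply, Matrix.smul_apply, Matrix.sum_apply, Pi.sub_apply,
        smul_eq_mul, Finset.sum_sub_distrib, Finset.sum_const, Finset.card_range, nsmul_eq_mul]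
      field_simp
    have hfi : Integrable f P := by
      simp only [hf, hidx, Matrix.smul_apply, Matrix.sum_apply, smul_eq_mul]
      refine (integrable_finsetSum _ fun k _ => ?_).const_mul _
      refine memLp_one_iff_integrable.mp (memLp_of_ae_abs_le (R := Amax)
        ((hSm (t + k) a b).mono (ℱ.le _) le_rfl) ?_ 1)
      filter_upwards [hAmax (t + k)] with ω hω
      exact (abs_entry_le_norm _ a b).trans hω
    rw [e]
    filter_upwards [hper.averaging ε hε t ht, condExp_sub hfi (integrable_const (A a b)) (ℱ t)]
      with ω h1 h2
    rw [h2, Pi.sub_apply, condExp_const (ℱ.le t)]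
    exact (abs_entry_le_norm _ a b).trans h1

end Model

/-! ### The mean-square error of the ensemble mean -/

section MeanSquare

variable {Ω : Type*} [mΩ : MeasurableSpace Ω] {P : Measure Ω} {p d : ℕ}
  {ℱ : Filtration ℕ mΩ} {S : ℕ → Ω → Matrix (Fin p) (Fin d) ℝ} {w : ℕ → Ω → Fin p → ℝ}
  {Γ : Matrix (Fin p) (Fin p) ℝ} {D : ℕ → Ω → Matrix (Fin d) (Fin d) ℝ} {α β σ : ℝ}

lemma measurableEntries_gain {B : ℕ → Ω → Matrix (Fin d) (Fin d) ℝ}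
    (hD : ∀ t, MeasurableEntries (ℱ t) (D t)) (hB : ∀ t, MeasurableEntries (ℱ (t + 1)) (B t))
    (t : ℕ) :
    MeasurableEntries (ℱ t) fun ω => gain (fun s => D s ω) (fun s => B s ω) t := by
  have hΦ : MeasurableEntries (ℱ t) fun ω => propagator (fun s => D s ω) (fun s => B s ω) t := by
    induction t with
    | zero => exact MeasurableEntries.const 1
    | succ t ih =>
      have hle := ℱ.mono (Nat.le_succ t)
      exact ((MeasurableEntries.const 1).sub (((hD t).mono hle).mul (hB t))).mul (ih.mono hle)
  exact ((hD 0).mono (ℱ.mono (Nat.zero_le t))).mul hΦ.transpose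

/-- The accumulated forcing, pulled back by the propagator, has second moments of logarithmic
growth: its parts are an averaged process with slowly varying weights, a remainder from the
resolvent, and a martingale driven by the noise. -/
lemma hasLogMoments_forcing [IsProbabilityMeasure P] (hm : IsObservationModel P ℱ S w Γ) {Amax : ℝ}
    (hAmax : ∀ t : ℕ, ∀ᵐ ω ∂P, ‖(S (t + 1) ω)ᵀ * S (t + 1) ω‖ ≤ Amax)
    {A : Matrix (Fin d) (Fin d) ℝ} {τ : ℝ → ℕ} (hper : IsPeriodicAveraging P ℱ S A τ)
    (hα : 0 < α) (hαβ : α ≤ β) (hσ : 0 < σ) (hd : 0 < d)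
    (hD : ∀ t, MeasurableEntries (ℱ t) (D t)) {B : ℕ → Ω → Matrix (Fin d) (Fin d) ℝ}
    (hB : ∀ t ω, B t ω = (S (t + 1) ω)ᵀ * S (t + 1) ω + α • (1 : Matrix (Fin d) (Fin d) ℝ))
    (hflow : ∀ᵐ ω ∂P, IsCovarianceFlow α β σ (fun t => D t ω) (fun t => B t ω))
    (v : Fin d → ℝ) (i : Fin d) :
    HasLogMoments P fun T ω => ∑ s ∈ Finset.range T,
      ((gain (fun t => D t ω) (fun t => B t ω) s * resolvent (fun t => D t ω) (fun t => B t ω) s) *ᵥ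
        (((S (s + 1) ω)ᵀ * S (s + 1) ω - A) *ᵥ v - (S (s + 1) ω)ᵀ *ᵥ w (s + 1) ω)) i := by
  obtain ⟨κ, hκ, hbd⟩ := IsCovarianceFlow.exists_gain_bounds (d := d) hα hαβ hσ hd
  have hA0 : 0 ≤ Amax := by
    obtain ⟨ω, hω⟩ := (hAmax 0).exists
    exact (norm_nonneg _).trans hω
  have hBpre : ∀ t, MeasurableEntries (IsObservationModel.preNoise ℱ S t) (B t) := fun t => by
    rw [show B t = _ from funext (hB t)]
    have hS := IsObservationModel.measurableEntries_operator (ℱ := ℱ) (S := S) t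
    exact (hS.transpose.mul hS).add (MeasurableEntries.const _)
  have hBm : ∀ t, MeasurableEntries (ℱ (t + 1)) (B t) := fun t => by
    rw [show B t = _ from funext (hB t)]
    have hS : MeasurableEntries (ℱ (t + 1)) (S (t + 1)) := hm.operator_adapted t
    exact (hS.transpose.mul hS).add (MeasurableEntries.const _)
  set G : ℕ → Ω → Matrix (Fin d) (Fin d) ℝ :=
    fun s ω => gain (fun t => D t ω) (fun t => B t ω) s with hG
  set R : ℕ → Ω → Matrix (Fin d) (Fin d) ℝ :=
    fun s ω => resolvent (fun t => D t ω) (fun t => B t ω) s with hR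
  have hGm : ∀ s, MeasurableEntries (ℱ s) (G s) := measurableEntries_gain hD hBm
  have hRinv : ∀ {m : MeasurableSpace Ω} s, MeasurableEntries m (D s) → MeasurableEntries m (B s) →
      MeasurableEntries m (R s) := fun s h1 h2 =>
    ((MeasurableEntries.const 1).sub (h2.mul h1)).inv
  have hGRpre : ∀ s, MeasurableEntries (IsObservationModel.preNoise ℱ S s)
      fun ω => G s ω * R s ω := fun s =>
    ((hGm s).mono le_sup_left).mul (hRinv s ((hD s).mono le_sup_left) (hBpre s))
  set g : Fin d → Fin d → ℕ → Ω → ℝ :=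
    fun a b s ω => ((S (s + 1) ω)ᵀ * S (s + 1) ω - A) a b with hg
  have havg : ∀ a b, IsAveraged P ℱ τ (Amax + ‖A‖) (g a b) := fun a b =>
    hper.isAveraged hm hAmax a b
  have hmain : ∀ a b, HasLogMoments P
      fun T ω => ∑ s ∈ Finset.range T, G s ω i a * g a b s ω := fun a b => by
    refine HasLogMoments.weighted_sum_of_isAveraged (havg a b) hκ (fun s => hGm s i a)
      (fun s => ?_) (fun s => ?_)
    · filter_upwards [hflow] with ω hω
      refine le_trans ?_ (hbd _ _ hω s).1
      exact sq_le_sq.mpr (by rw [abs_norm]; exact abs_entry_le_norm _ i a)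
    · filter_upwards [hflow] with ω hω
      exact (abs_entry_le_norm (G (s + 1) ω - G s ω) i a).trans (hbd _ _ hω s).2.1
  have hrem : ∀ a b, HasLogMoments P
      fun T ω => ∑ s ∈ Finset.range T, (G s ω * R s ω - G s ω) i a * g a b s ω := fun a b => by
    refine HasLogMoments.weighted_sum_of_inv hκ (fun s => ?_) (havg a b).measurable (fun s => ?_)
      (havg a b).bounded
    · exact ((hGRpre s).mono (hm.preNoise_le s)).sub ((hGm s).mono (ℱ.le s)) i a
    · filter_upwards [hflow] with ω hω
      exact (abs_entry_le_norm _ i a).trans (hbd _ _ hω s).2.2.2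
  have hnoise : ∀ j, HasLogMoments P fun T ω =>
      ∑ s ∈ Finset.range T, (G s ω * R s ω * (S (s + 1) ω)ᵀ) i j * w (s + 1) ω j := fun j => by
    have hpre : ∀ s, Measurable[IsObservationModel.preNoise ℱ S s]
        fun ω => (G s ω * R s ω * (S (s + 1) ω)ᵀ) i j := fun s =>
      ((hGRpre s).mul (IsObservationModel.measurableEntries_operator s).transpose) i j
    have hpost : ∀ s, Measurable[ℱ (s + 1)]
        fun ω => (G s ω * R s ω * (S (s + 1) ω)ᵀ) i j := fun s => by
      have hle := ℱ.mono (Nat.le_succ s)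
      exact ((((hGm s).mono hle).mul (hRinv s ((hD s).mono hle) (hBm s))).mul
        (MeasurableEntries.transpose (hm.operator_adapted s))) i j
    refine HasLogMoments.martingale_transform (κ := κ * Amax)
      (ν := ∫ x : EuclideanSpace ℝ (Fin p), x j ^ 2 ∂(multivariateGaussian 0 Γ)) hm.preNoise_le
      (by positivity) (integral_nonneg fun x => sq_nonneg _) hpre (fun s k hk => ?_)
      (fun s => hm.memLp_noise s j) (fun s => hm.condExp_noise s j) (fun s => ?_)
      (fun s => (hm.integral_noise_sq s j).le)
    · exact ((hpost k).mul (hm.measurable_noise k j)).mono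
        ((ℱ.mono hk).trans le_sup_left) le_rfl
    · filter_upwards [hflow, hAmax s] with ω hω hSω
      rw [norm_transpose_mul_self] at hSω
      have h1 := (hbd _ _ hω s).2.2.1
      have h2 : |(G s ω * R s ω * (S (s + 1) ω)ᵀ) i j| ≤ ‖G s ω * R s ω‖ * ‖S (s + 1) ω‖ := by
        refine (abs_entry_le_norm _ i j).trans ((Matrix.l2_opNorm_mul _ _).trans ?_)
        rw [norm_transpose]
      calc _ = |(G s ω * R s ω * (S (s + 1) ω)ᵀ) i j| ^ 2 := (sq_abs _).symm
        _ ≤ (‖G s ω * R s ω‖ * ‖S (s + 1) ω‖) ^ 2 := by gcongr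
        _ = ‖G s ω * R s ω‖ ^ 2 * ‖S (s + 1) ω‖ ^ 2 := by ring
        _ ≤ κ / (s + 1) * Amax := mul_le_mul h1 hSω (sq_nonneg _) (by positivity)
        _ = _ := by ring
  have htotal := ((HasLogMoments.sum Finset.univ fun a _ => HasLogMoments.sum Finset.univ
      fun b _ => ((hmain a b).add (hrem a b)).const_mul (v b))).add
    (HasLogMoments.sum Finset.univ fun j _ => (hnoise j).const_mul (-1))
  convert htotal using 3 with T ω
  have hterm : ∀ s, ((G s ω * R s ω) *ᵥ
      (((S (s + 1) ω)ᵀ * S (s + 1) ω - A) *ᵥ v - (S (s + 1) ω)ᵀ *ᵥ w (s + 1) ω)) i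
      = (∑ a, ∑ b, v b * (G s ω i a * g a b s ω + (G s ω * R s ω - G s ω) i a * g a b s ω))
        + ∑ j, -1 * ((G s ω * R s ω * (S (s + 1) ω)ᵀ) i j * w (s + 1) ω j) := fun s => by
    rw [Matrix.mulVec_sub, Matrix.mulVec_mulVec _ (G s ω * R s ω) (S (s + 1) ω)ᵀ, Pi.sub_apply,
      sub_eq_add_neg]
    congr 1
    · simp only [Matrix.mulVec, dotProduct, Finset.mul_sum]
      refine Finset.sum_congr rfl fun a _ => Finset.sum_congr rfl fun b _ => ?_
      rw [Matrix.sub_apply (G s ω * R s ω)]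
      simp only [hg]
      ring
    · simp [Matrix.mulVec, dotProduct]
  rw [Finset.sum_congr rfl fun s _ => hterm s, Finset.sum_add_distrib, Finset.sum_comm]
  congr 1
  · refine Finset.sum_congr rfl fun a _ => ?_
    rw [Finset.sum_comm]
    refine Finset.sum_congr rfl fun b _ => ?_
    rw [← Finset.sum_add_distrib, Finset.mul_sum]
  · rw [Finset.sum_comm]
    refine Finset.sum_congr rfl fun j _ => ?_
    rw [Finset.mul_sum]

/-- The error of the ensemble mean is of order `(log T)⁴ / T` in mean square. -/
lemma exists_integral_error_le {x : ℕ → Ω → Fin d → ℝ} {B : ℕ → Ω → Matrix (Fin d) (Fin d) ℝ}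
    {ξ : ℕ → Ω → Fin d → ℝ} (hα : 0 < α) (hαβ : α ≤ β) (hσ : 0 < σ) (hd : 0 < d)
    (hflow : ∀ᵐ ω ∂P, IsCovarianceFlow α β σ (fun t => D t ω) (fun t => B t ω))
    (hxm : ∀ t i, Measurable fun ω => x t ω i) (hx0 : ∀ i, MemLp (fun ω => x 0 ω i) 2 P)
    (hx : ∀ t ω, x (t + 1) ω = x t ω - D t ω *ᵥ (B t ω *ᵥ x t ω + ξ t ω))
    (hξ : ∀ i, HasLogMoments P fun T ω => ∑ s ∈ Finset.range T,
      ((gain (fun t => D t ω) (fun t => B t ω) s * resolvent (fun t => D t ω) (fun t => B t ω) s)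
        *ᵥ ξ s ω) i) :
    ∃ K : ℝ, 0 ≤ K ∧ ∀ T : ℕ, Integrable (fun ω => x T ω ⬝ᵥ x T ω) P ∧
      ∫ ω, x T ω ⬝ᵥ x T ω ∂P ≤ K * ((1 + Real.log T) ^ 4 / (T + 1)) := by
  set y : ℕ → Ω → Fin d → ℝ := fun T ω => x 0 ω - ∑ s ∈ Finset.range T,
    (gain (fun t => D t ω) (fun t => B t ω) s * resolvent (fun t => D t ω) (fun t => B t ω) s)
      *ᵥ ξ s ω with hy
  have hyL : ∀ i, HasLogMoments P fun T ω => y T ω i := fun i => by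
    convert (HasLogMoments.of_memLp (hx0 i)).add ((hξ i).const_mul (-1)) using 3 with T ω
    simp only [hy, Pi.sub_apply, Finset.sum_apply]
    ring
  choose K hK hyK using fun i => (hyL i).2
  set k := (d : ℝ) / α / σ with hk
  have hk0 : 0 ≤ k := by positivity
  refine ⟨k * ∑ i, K i, mul_nonneg hk0 (Finset.sum_nonneg fun i _ => hK i), fun T => ?_⟩
  have hle : ∀ᵐ ω ∂P, x T ω ⬝ᵥ x T ω ≤ k / (T + 1) * ∑ i, y T ω i ^ 2 := by
    filter_upwards [hflow] with ω hω
    have e := hω.eq_propagator_mulVec hα hαβ hd (x := fun t => x t ω) (ξ := fun t => ξ t ω)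
      (fun t => hx t ω) T
    change x T ω = propagator _ _ T *ᵥ y T ω at e
    rw [e]
    refine (dotProduct_self_mulVec_le _ _).trans ?_
    have e2 : ∀ u : Fin d → ℝ, u ⬝ᵥ u = ∑ i, u i ^ 2 := fun u => by
      simp [dotProduct, pow_two]
    rw [e2]
    exact mul_le_mul_of_nonneg_right (hω.norm_propagator_sq_le hα hαβ hσ hd T)
      (Finset.sum_nonneg fun i _ => sq_nonneg _)
  have hyi : ∀ i, Integrable (fun ω => y T ω i ^ 2) P := fun i => ((hyL i).1 T).integrable_sq
  have hbi : Integrable (fun ω => k / (T + 1) * ∑ i, y T ω i ^ 2) P :=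
    (integrable_finsetSum _ fun i _ => hyi i).const_mul _
  have hxi : Integrable (fun ω => x T ω ⬝ᵥ x T ω) P := by
    refine hbi.mono' (Finset.measurable_fun_sum _
      fun i _ => (hxm T i).mul (hxm T i)).aestronglyMeasurable ?_
    filter_upwards [hle] with ω hω
    have h0 : 0 ≤ x T ω ⬝ᵥ x T ω := Finset.sum_nonneg fun i _ => mul_self_nonneg _
    rwa [Real.norm_of_nonneg h0]
  refine ⟨hxi, (integral_mono_ae hxi hbi hle).trans ?_⟩
  rw [integral_const_mul, integral_finsetSum _ fun i _ => hyi i]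
  calc _ ≤ k / (T + 1) * ∑ i, K i * (1 + Real.log T) ^ 4 :=
        mul_le_mul_of_nonneg_left (Finset.sum_le_sum fun i _ => hyK i T) (by positivity)
    _ = _ := by rw [← Finset.sum_mul]; ring

lemma measurable_ensemble {J : ℕ} (hm : IsObservationModel P ℱ S w Γ) {h : ℝ} {zstar : Fin d → ℝ}
    {z₀ : Ω → Fin J → Fin d → ℝ} (hz₀ : Measurable[ℱ 0] z₀) (t : ℕ) (j : Fin J) (i : Fin d) :
    Measurable[ℱ t] fun ω => ensemble α h (fun s => S s ω)
      (fun s => observation S w zstar s ω) (z₀ ω) t j i := by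
  induction t generalizing j i with
  | zero => exact (measurable_pi_apply i).comp ((measurable_pi_apply j).comp hz₀)
  | succ t ih =>
    have hle := ℱ.mono (Nat.le_succ t)
    have hS : MeasurableEntries (ℱ (t + 1)) (S (t + 1)) := hm.operator_adapted t
    have hz : ∀ j i, Measurable[ℱ (t + 1)] fun ω => ensemble α h (fun s => S s ω)
        (fun s => observation S w zstar s ω) (z₀ ω) t j i := fun j i =>
      (ih j i).mono hle le_rfl
    have hC := measurableEntries_sampleCov hz
    have hu : ∀ i, Measurable[ℱ (t + 1)] fun ω => observation S w zstar (t + 1) ω i := fun i =>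
      (hS.mulVec (v := fun _ => zstar) (fun j => measurable_const) i).add (hm.measurable_noise t i)
    simp only [ensemble, step, Pi.sub_apply, Pi.smul_apply, smul_eq_mul]
    refine (hz j i).sub ((hC.mulVec (fun b => ?_) i).const_mul h)
    exact (hS.transpose.mulVec (fun a => (hS.mulVec (hz j) a).sub (hu a)) b).add
      ((hz j b).const_mul α)

/-- Any power of the logarithm is absorbed by the gap between the exponents `1` and `lam`. -/
lemma exists_log_pow_div_le {lam : ℝ} (hlam : lam < 1) :
    ∃ K : ℝ, 0 ≤ K ∧ ∀ T : ℕ, 1 ≤ T →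
      (1 + Real.log T) ^ 4 / ((T : ℝ) + 1) ≤ K * (1 / (T : ℝ) ^ lam) := by
  set θ := (1 - lam) / 4 with hθ
  have hθ0 : 0 < θ := by rw [hθ]; linarith
  refine ⟨(1 + 1 / θ) ^ 4, by positivity, fun T hT => ?_⟩
  have hT1 : (1 : ℝ) ≤ T := Nat.one_le_cast.mpr hT
  have hT0 : (0 : ℝ) < T := by linarith
  have h1 : 1 + Real.log T ≤ (1 + 1 / θ) * (T : ℝ) ^ θ := by
    have h2 := Real.log_le_rpow_div hT0.le hθ0
    have h3 := Real.one_le_rpow hT1 hθ0.le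
    calc 1 + Real.log T ≤ (T : ℝ) ^ θ + (T : ℝ) ^ θ / θ := add_le_add h3 h2
      _ = _ := by ring
  have h4 : (1 + Real.log T) ^ 4 ≤ (1 + 1 / θ) ^ 4 * ((T : ℝ) / (T : ℝ) ^ lam) := by
    calc _ ≤ ((1 + 1 / θ) * (T : ℝ) ^ θ) ^ 4 :=
          pow_le_pow_left₀ (by linarith [one_le_one_add_log T]) h1 4
      _ = (1 + 1 / θ) ^ 4 * ((T : ℝ) ^ θ) ^ 4 := by ring
      _ = _ := by
        rw [← Real.rpow_natCast ((T : ℝ) ^ θ) 4, ← Real.rpow_mul hT0.le,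
          show θ * ((4 : ℕ) : ℝ) = 1 - lam by rw [hθ]; push_cast; ring,
          Real.rpow_sub hT0, Real.rpow_one]
  calc _ ≤ (1 + Real.log T) ^ 4 / (T : ℝ) := by
        gcongr
        linarith
    _ ≤ (1 + 1 / θ) ^ 4 * ((T : ℝ) / (T : ℝ) ^ lam) / T := by gcongr
    _ = _ := by field_simp

end MeanSquare

end DEKI

theorem theorem2 {Ω : Type*} [mΩ : MeasurableSpace Ω] (P : Measure Ω) [IsProbabilityMeasure P]
    (J p d : ℕ) (ℱ : Filtration ℕ mΩ)
    (S : ℕ → Ω → Matrix (Fin p) (Fin d) ℝ) (w : ℕ → Ω → Fin p → ℝ)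
    (zstar : Fin d → ℝ) (Γ : Matrix (Fin p) (Fin p) ℝ) (hΓ : Γ.PosDef)
    (hmodel : DEKI.IsObservationModel P ℱ S w Γ)
    -- uniform bound on the matrices `SₜᵀSₜ`
    (Amax : ℝ) (hAmax : ∀ t : ℕ, ∀ᵐ ω ∂P, ‖(S (t + 1) ω)ᵀ * S (t + 1) ω‖ ≤ Amax)
    -- periodic averaging assumption
    (A : Matrix (Fin d) (Fin d) ℝ) (τ : ℝ → ℕ)
    (hper : DEKI.IsPeriodicAveraging P ℱ S A τ)
    -- regularization parameter, and a strong convexity constant of the objective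
    (α : ℝ) (hα : 0 < α) (μ : ℝ) (hμ : 0 < μ)
    (hconvex : (A + α • (1 : Matrix (Fin d) (Fin d) ℝ)
      - μ • (1 : Matrix (Fin d) (Fin d) ℝ)).PosSemidef)
    -- initial ensemble
    (z₀ : Ω → Fin J → Fin d → ℝ) (hz₀ : Measurable[ℱ 0] z₀)
    (hz₀L2 : ∀ j i, MemLp (fun ω => z₀ ω j i) 2 P)
    (σl : ℝ) (hσl : 0 < σl)
    (hC₀ : ∀ᵐ ω ∂P,
      (DEKI.sampleCov (z₀ ω) - σl • (1 : Matrix (Fin d) (Fin d) ℝ)).PosDef)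
    (lam : ℝ) (hlam : lam = σl * (2 * μ)) (hlam0 : 0 < lam) (hlam1 : lam < 1)
    -- constant step size
    (h : ℝ) (hh : 0 < h)
    (hstep : ∀ᵐ ω ∂P,
      h ≤ min (α / ((J : ℝ) * (Amax + α) ^ 2)) ((J : ℝ) / α) * (DEKI.spread (z₀ ω))⁻¹)
    -- the ensemble and the excess loss at its mean
    (z : ℕ → Ω → Fin J → Fin d → ℝ)
    (hz : ∀ t ω, z t ω = DEKI.ensemble α h (fun s => S s ω)
      (fun s => DEKI.observation S w zstar s ω) (z₀ ω) t)
    (excess : ℕ → Ω → ℝ)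
    (hexcess : ∀ t ω, excess t ω = DEKI.objective A α zstar (DEKI.ensembleMean (z t ω))
      - DEKI.objective A α zstar (DEKI.zOpt A α zstar)) :
    (∀ T : ℕ, Integrable (excess T) P) ∧
    (∃ K : ℝ, ∀ ε : ℝ, 0 < ε → ∀ T : ℕ, 1 ≤ T →
      ∫ ω, excess T ω ∂P ≤
        K * (ε + (1 + (1 + Real.log (τ ε)) ^ 2
          + (1 + Real.log (τ ε)) * (1 + Real.log T)) / (T : ℝ) ^ lam)) ∧
    (∃ K : ℝ, ∀ T : ℕ, 2 ≤ T →
      ∫ ω, excess T ω ∂P ≤ K * (Real.log T ^ 2 / (T : ℝ) ^ lam)) := by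
  set v := DEKI.zOpt A α zstar - zstar with hv
  set x : ℕ → Ω → Fin d → ℝ :=
    fun t ω => DEKI.ensembleMean (z t ω) - DEKI.zOpt A α zstar with hxdef
  set D : ℕ → Ω → Matrix (Fin d) (Fin d) ℝ := fun t ω => h • DEKI.sampleCov (z t ω) with hDdef
  set B : ℕ → Ω → Matrix (Fin d) (Fin d) ℝ := fun t ω =>
    (S (t + 1) ω)ᵀ * S (t + 1) ω + α • (1 : Matrix (Fin d) (Fin d) ℝ) with hBdef
  have hall : ∀ᵐ ω ∂P, 0 < d ∧ 0 < J ∧ 0 ≤ Amax ∧ DEKI.IsCovarianceFlow α (Amax + α) (h * σl)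
      (fun t => D t ω) (fun t => B t ω) := by
    filter_upwards [ae_all_iff.mpr hAmax, hC₀, hstep] with ω h1 h2 h3
    simp only [hDdef, hz]
    exact DEKI.isCovarianceFlow_ensemble hα hh h1 hσl h2 h3
  obtain ⟨hd, hJ, hA0, -⟩ := hall.exists.choose_spec
  have hflow := hall.mono fun ω hω => hω.2.2.2
  have hσ : 0 < h * σl := mul_pos hh hσl
  have hαβ : α ≤ Amax + α := by linarith
  have hzm : ∀ t j i, Measurable[ℱ t] fun ω => z t ω j i := fun t j i => by
    simp only [hz]
    exact DEKI.measurable_ensemble hmodel hz₀ t j i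
  have hDm : ∀ t, DEKI.MeasurableEntries (ℱ t) (D t) := fun t =>
    (DEKI.measurableEntries_sampleCov (hzm t)).const_smul h
  have hxm : ∀ t i, Measurable fun ω => x t ω i := fun t i => by
    simp only [hxdef, DEKI.ensembleMean, Pi.sub_apply, Pi.smul_apply, Finset.sum_apply, smul_eq_mul]
    exact ((Finset.measurable_fun_sum _ fun j _ =>
      (hzm t j i).mono (ℱ.le t) le_rfl).const_mul _).sub_const _
  have hx0 : ∀ i, MemLp (fun ω => x 0 ω i) 2 P := fun i => by
    simp only [hxdef, hz, DEKI.ensemble, DEKI.ensembleMean, Pi.sub_apply, Pi.smul_apply,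
      Finset.sum_apply, smul_eq_mul]
    exact ((memLp_finsetSum _ fun j _ => hz₀L2 j i).const_mul _).sub (memLp_const _)
  have hx : ∀ t ω, x (t + 1) ω = x t ω - D t ω *ᵥ (B t ω *ᵥ x t ω +
      (((S (t + 1) ω)ᵀ * S (t + 1) ω - A) *ᵥ v - (S (t + 1) ω)ᵀ *ᵥ w (t + 1) ω)) := fun t ω => by
    simp only [hxdef, hDdef, hBdef, hz, DEKI.ensemble]
    exact DEKI.ensembleMean_step_sub_zOpt hJ hper.posSemidef hα h _ zstar _ _
  obtain ⟨K, hK, hKx⟩ := DEKI.exists_integral_error_le hα hαβ hσ hd hflow hxm hx0 hx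
    (DEKI.hasLogMoments_forcing hmodel hAmax hper hα hαβ hσ hd hDm (fun _ _ => rfl) hflow v)
  have hbound : ∀ T ω, 0 ≤ excess T ω ∧ excess T ω ≤ (1 + α) / 2 * (x T ω ⬝ᵥ x T ω) :=
    fun T ω => by
      rw [hexcess]
      exact DEKI.objective_sub_objective_zOpt_bounds hper.posSemidef hper.le_one hα zstar _
  have hint : ∀ T, Integrable (excess T) P := fun T => by
    refine ((hKx T).1.const_mul ((1 + α) / 2)).mono' ?_ (ae_of_all _ fun ω => ?_)
    · have e : excess T = fun ω => 1 / 2 * (x T ω ⬝ᵥ (A *ᵥ x T ω)) + α / 2 * (x T ω ⬝ᵥ x T ω) :=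
        funext fun ω => by
          rw [hexcess]
          exact DEKI.objective_sub_objective_zOpt hper.posSemidef hα zstar _
      rw [e]
      refine Measurable.aestronglyMeasurable (((Finset.measurable_fun_sum _ fun i _ =>
        (hxm T i).mul ?_).const_mul _).add ((Finset.measurable_fun_sum _ fun i _ =>
        (hxm T i).mul (hxm T i)).const_mul _))
      exact (DEKI.MeasurableEntries.const A).mulVec (hxm T) i
    · rw [Real.norm_of_nonneg (hbound T ω).1]
      exact (hbound T ω).2
  obtain ⟨K', hK', hlog⟩ := DEKI.exists_log_pow_div_le hlam1
  set K₀ := (1 + α) / 2 * (K * K') with hK₀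
  have hK₀0 : 0 ≤ K₀ := by positivity
  have hrate : ∀ T : ℕ, 1 ≤ T → ∫ ω, excess T ω ∂P ≤ K₀ * (1 / (T : ℝ) ^ lam) := fun T hT => by
    calc ∫ ω, excess T ω ∂P ≤ ∫ ω, (1 + α) / 2 * (x T ω ⬝ᵥ x T ω) ∂P :=
          integral_mono (hint T) ((hKx T).1.const_mul _) fun ω => (hbound T ω).2
      _ = (1 + α) / 2 * ∫ ω, x T ω ⬝ᵥ x T ω ∂P := integral_const_mul _ _
      _ ≤ (1 + α) / 2 * (K * (K' * (1 / (T : ℝ) ^ lam))) := by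
          refine mul_le_mul_of_nonneg_left ((hKx T).2.trans ?_) (by positivity)
          exact mul_le_mul_of_nonneg_left (hlog T hT) hK
      _ = _ := by rw [hK₀]; ring
  refine ⟨hint, ⟨K₀, fun ε hε T hT => (hrate T hT).trans ?_⟩,
    ⟨K₀ / Real.log 2 ^ 2, fun T hT => (hrate T (by omega)).trans ?_⟩⟩
  · -- `1 / T ^ lam` is at most the second summand, as all logarithms are nonnegative
    have hτ := Real.log_natCast_nonneg (τ ε)
    have hlT := Real.log_natCast_nonneg T
    have hTl : (0 : ℝ) < (T : ℝ) ^ lam := Real.rpow_pos_of_pos (Nat.cast_pos.mpr hT) _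
    refine mul_le_mul_of_nonneg_left ?_ hK₀0
    have h1 : 1 / (T : ℝ) ^ lam ≤ (1 + (1 + Real.log (τ ε)) ^ 2
        + (1 + Real.log (τ ε)) * (1 + Real.log T)) / (T : ℝ) ^ lam := by
      gcongr
      have h2 : 0 ≤ (1 + Real.log (τ ε)) * (1 + Real.log T) := by positivity
      have h3 := sq_nonneg (1 + Real.log (τ ε))
      linarith
    linarith
  · have hl2 : 0 < Real.log 2 := Real.log_pos one_lt_two
    have hlT : Real.log 2 ≤ Real.log T := Real.log_le_log two_pos (by exact_mod_cast hT)
    have hTl : (0 : ℝ) < (T : ℝ) ^ lam :=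
      Real.rpow_pos_of_pos (Nat.cast_pos.mpr (by omega)) _
    have h1 : Real.log 2 ^ 2 ≤ Real.log T ^ 2 := pow_le_pow_left₀ hl2.le hlT 2
    calc K₀ * (1 / (T : ℝ) ^ lam)
        = K₀ / Real.log 2 ^ 2 * (Real.log 2 ^ 2 / (T : ℝ) ^ lam) := by field_simp
      _ ≤ _ := by gcongr
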